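/- **Model.** Let $n,m\ge 1$. Let $w_1,\dots,w_{mn+1}$ be independent exponential random variables with mean $1$, put $W_0=0$, $W_j=\sum_{i\le j}w_i$, $\mathbf W=(W_j)$, and $R_k=W_k/W_{mn+1}$ for $0\le k\le mn$. Conditioned on $\mathbf W$, let $\ell_1,\dots,\ell_{mn}$ be independent, $\ell_k$ having density $\frac1{2\sqrt{R_kx}}$ on $(0,R_k]$. The multigraph $G_1^{mn}$ on $\{1,\dots,mn\}$ has, for each $k$, one edge (possibly a loop) joining $k$ to the vertex $i\le k$ with $\ell_k\in(R_{i-1},R_i]$; the preferential attachment graph $G_m^n$ on $\{1,\dots,n\}$ is obtained from it by merging the vertices $m(j-1)+1,\dots,mj$ into one vertex $j$, for each $j\le n$. **Notation.** For $\delta\in(0,1)$ let $$\mathcal W=\bigcap_{\delta n\le j\le n}\Bigl\{\tfrac{W_{mj}}{mj}\le 1+n^{-1/2}\log n\Bigr\}\quad(j\text{ integer}),\qquad c(\varepsilon,\delta)=\frac{2\varepsilon^2\sqrt\delta}{(1+\sqrt\delta)^2}.$$ Put $N=n+1$ and $$h(\mu,\nu)=4\bigl(\sqrt{N-\nu}-\sqrt{N-\mu-\nu}\bigr)\bigl(\sqrt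 N-\sqrt{N-\nu}\bigr),\qquad g(\mu,\nu)=\min\bigl(h(\mu,\nu),h(\nu,\mu)\bigr),$$ $$D(\mu,\nu,r)=\sqrt{N-\mu-r}+\sqrt{N-\mu+r}-\sqrt{N-\mu-\nu+r}-\sqrt{N-r},$$ $$d_1=4\bigl(2\sqrt{N-\mu}-\sqrt{N-\mu-r}-\sqrt{N-\mu+r}\bigr)\bigl(\sqrt{N-\mu-r}-\sqrt{N-\mu-\nu}-\sqrt N+\sqrt{N-\mu+r}\bigr),$$ $$d_2=4\bigl(\sqrt{N-\mu-\nu+r}-\sqrt{N-\mu-\nu}-\sqrt N+\sqrt{N-r}\bigr)\bigl(2\sqrt{N-\mu}-\sqrt{N-\mu-\nu+r}-\sqrt{N-r}\bigr),$$ $$g(\mu,\nu,r)=g(\mu,\nu)+d(\mu,\nu,r),\qquad d(\mu,\nu,r)=\begin{cases}d_1,& D(\mu,\nu,r)\ge0,\\ d_2,& D(\mu,\nu,r)<0\end{cases}$$ (if $D(\mu,\nu,r)=0$ then $d_1=d_2$). **Theorem.** There is a sequence $c(n)\in(0,\tfrac12]$ with $c(n)\to\tfrac12$ as $n\to\infty$,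 depending on $n$ only, such that the following holds for all integers $n,m\ge1$ and $0\le r\le\mu\le\nu$ and all reals $\delta,\varepsilon\in(0,1)$ with $\mu+\nu=(1-\delta)n$. Let $\mathbb P(\mu,\nu,r)$ be the probability that $\mathcal W$ holds and that there are disjoint vertex sets $A,B$ of $G_m^n$ with $|A|=\mu$, $|B|=\nu$, with exactly $\mu-r$ elements of $A$ among the $\mu$ largest elements of $A\cup B$, such that no pair $(a,b)$, $a\in A$, $b\in B$, is an edge of $G_m^n$. Then $$\mathbb P(\mu,\nu,r)\le\binom n{\mu+\nu}\binom\mu r\binom\nu r\Bigl[\exp\Bigl(-m\,c(\varepsilon,\delta)\frac{\mu\nu}{\mu+\nu}\Bigr)+\exp\bigl(-m\,c(n)(1-\varepsilon)\,g(\mu,\nu,r)\bigr)\Bigr],$$ where $\frac{\mu\nu}{\mu+\nu}$ is read as $0$ if $\mu=\nu=0$. -/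

import Mathlib

open MeasureTheory ProbabilityTheory Filter Topology

namespace PrefAttach

noncomputable section

/-! ### The random pairing model

Indices start at `0`: the exponential variable `w i`, the chord `k` and the vertex `a` below are
the `(i+1)`-st variable, the `(k+1)`-st chord and the `(a+1)`-st vertex in the usual count. -/

/-- The partial sum `W_j` of the first `j` variables, with `W_0 = 0`. -/
def partialSum {N : ℕ} (w : Fin (N + 1) → ℝ) (j : ℕ) : ℝ :=
  ∑ i : Fin (N + 1) with i.val < j, w i

/-- `R_j = W_j / W_{N+1}`, the `j`-th smallest right endpoint (`1 ≤ j ≤ N`), with `R_0 = 0`. -/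
def rightEnd {N : ℕ} (w : Fin (N + 1) → ℝ) (j : ℕ) : ℝ :=
  partialSum w j / partialSum w (N + 1)

/-- The density `1 / (2 √(r x))` on `(0, r]` of a left endpoint whose right endpoint is `r`. -/
def leftDensity (r x : ℝ) : ENNReal :=
  ENNReal.ofReal (if 0 < x ∧ x ≤ r then 1 / (2 * √(r * x)) else 0)

/-- The joint law of `(w, ℓ)` for `N` chords: `w` consists of `N + 1` independent exponential
variables with mean one and, conditioned on `w`, the left endpoints `ℓ k` are independent with
densities `leftDensity (R_{k+1})`. -/
def pairingMeasure (N : ℕ) : Measure ((Fin (N + 1) → ℝ) × (Fin N → ℝ)) :=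
  ((Measure.pi fun _ : Fin (N + 1) => expMeasure 1).prod volume).withDensity
    fun p => ∏ k : Fin N, leftDensity (rightEnd p.1 (k.val + 1)) (p.2 k)

/-- The point `x` belongs to the `i`-th vertex of the graph of the chord diagram: the `i`-th right
endpoint is the first one that is at least `x`. -/
def InChordVertex {N : ℕ} (w : Fin (N + 1) → ℝ) (x : ℝ) (i : Fin N) : Prop :=
  x ≤ rightEnd w (i.val + 1) ∧ ∀ j : Fin N, j < i → rightEnd w (j.val + 1) < x

theorem InChordVertex.unique {N : ℕ} {w : Fin (N + 1) → ℝ} {x : ℝ} {i j : Fin N}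
    (hi : InChordVertex w x i) (hj : InChordVertex w x j) : i = j := by
  rcases lt_trichotomy i j with h | h | h
  · exact absurd hi.1 (not_le.mpr (hj.2 i h))
  · exact h
  · exact absurd hj.1 (not_le.mpr (hi.2 j h))

/-- The vertex of `G_m^n` formed by the block of `m` consecutive vertices of `G_1^{nm}` that
contains `i`; its index is the integer part of `i / m`. -/
def block {n m : ℕ} (i : Fin (n * m)) : Fin n := i.divNat

/-- The multigraph `G_m^n` of the endpoints `(w, ℓ)`: the edge of the chord `k` joins the vertex
that contains the left endpoint `ℓ k` to the vertex that contains the `k`-th right endpoint. -/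
def prefGraph (n m : ℕ) (w : Fin (n * m + 1) → ℝ) (l : Fin (n * m) → ℝ) :
    Graph (Fin n) (Fin (n * m)) where
  vertexSet := Set.univ
  IsLink k a b := ∃ i : Fin (n * m), InChordVertex w (l k) i ∧ s(a, b) = s(block i, block k)
  isLink_symm := by
    rintro k -
    refine ⟨?_⟩
    rintro a b ⟨i, hi, h⟩
    exact ⟨i, hi, by rw [Sym2.eq_swap, h]⟩
  eq_or_eq_of_isLink_of_isLink := by
    rintro k a b c d ⟨i, hi, h⟩ ⟨j, hj, h'⟩
    obtain rfl := hi.unique hj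
    rw [← h'] at h
    rcases Sym2.eq_iff.mp h with h | h
    · exact Or.inl h.1
    · exact Or.inr h.1
  left_mem_of_isLink := by intros; trivial

/-! ### The events -/

/-- The event that `W_{mj} / (mj) ≤ 1 + n^{-1/2} log n` for every integer `j` in `[δ n, n]`. -/
def eventW (n m : ℕ) (δ : ℝ) : Set ((Fin (n * m + 1) → ℝ) × (Fin (n * m) → ℝ)) :=
  {p | ∀ j : ℕ, δ * n ≤ j → j ≤ n →
    partialSum p.1 (m * j) / (m * j : ℝ) ≤ 1 + (√(n : ℝ))⁻¹ * Real.log n}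

/-- The `k` largest elements of `C` (all of `C` if it has at most `k` elements). -/
def largest {n : ℕ} (k : ℕ) (C : Finset (Fin n)) : Finset (Fin n) :=
  {x ∈ C | Finset.card {y ∈ C | x < y} < k}

/-- The event that there are disjoint vertex sets `A` and `B` of sizes `μ` and `ν`, with exactly
`μ - r` elements of `A` among the `μ` largest elements of `A ∪ B`, that no edge joins. -/
def eventNoEdge (n m μ ν r : ℕ) : Set ((Fin (n * m + 1) → ℝ) × (Fin (n * m) → ℝ)) :=
  {p | ∃ A B : Finset (Fin n), Disjoint A B ∧ A.card = μ ∧ B.card = ν ∧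
    (A ∩ largest μ (A ∪ B)).card = μ - r ∧
    ∀ a ∈ A, ∀ b ∈ B, ¬ (prefGraph n m p.1 p.2).Adj a b}

/-- The probability `P(μ, ν, r)`. -/
def probNoEdge (n m μ ν r : ℕ) (δ : ℝ) : ENNReal :=
  pairingMeasure (n * m) (eventW n m δ ∩ eventNoEdge n m μ ν r)

/-! ### The explicit functions in the bound

In `h`, `g`, `bigD`, `d₁`, `d₂`, `d` and `gr`, the first variable `N` stands for `n + 1`. -/

/-- `c(ε, δ)`. -/
def cc (ε δ : ℝ) : ℝ := 2 * ε ^ 2 * √δ / (1 + √δ) ^ 2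

/-- `h(μ, ν)`. -/
def h (N μ ν : ℝ) : ℝ := 4 * (√(N - ν) - √(N - μ - ν)) * (√N - √(N - ν))

/-- `g(μ, ν)`. -/
def g (N μ ν : ℝ) : ℝ := min (h N μ ν) (h N ν μ)

/-- `D(μ, ν, r)`. -/
def bigD (N μ ν r : ℝ) : ℝ := √(N - μ - r) + √(N - μ + r) - √(N - μ - ν + r) - √(N - r)

/-- `d_1(μ, ν, r)`. -/
def d₁ (N μ ν r : ℝ) : ℝ :=
  4 * (2 * √(N - μ) - √(N - μ - r) - √(N - μ + r)) *
    (√(N - μ - r) - √(N - μ - ν) - √N + √(N - μ + r))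

/-- `d_2(μ, ν, r)`. -/
def d₂ (N μ ν r : ℝ) : ℝ :=
  4 * (√(N - μ - ν + r) - √(N - μ - ν) - √N + √(N - r)) *
    (2 * √(N - μ) - √(N - μ - ν + r) - √(N - r))

open Classical in
/-- `d(μ, ν, r)`; where `D(μ, ν, r) = 0`, the values of `d_1` and `d_2` agree. -/
def d (N μ ν r : ℝ) : ℝ := if 0 ≤ bigD N μ ν r then d₁ N μ ν r else d₂ N μ ν r

/-- `g(μ, ν, r)`. -/
def gr (N μ ν r : ℝ) : ℝ := g N μ ν + d N μ ν r

end

end PrefAttach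

/-! Fix a pair `A`, `B` and put `C = A ∪ B`. Given the exponential variables the chords are
independent, and `√x / √R_k` is the distribution function of a left endpoint. A chord therefore
misses its forbidden intervals with probability one minus a sum of terms `(√R_j - √R_i) / √R_k`,
which is at most the exponential of minus that sum.

Writing `√y - √x = (y - x) / (√y + √x)` turns the exponent into increments of the partial sums
divided by square roots of partial sums. An element of `C` with `t` elements of `C` above it has
position at most `n - t`, and `n - t ≥ δn`, so the event 𝒲 controls these square roots. The exponent
is then at least `rateConst n * Y`, where `Y` is a linear combination of the exponential variables,
with nonnegative coefficients and mean `m * U * V`; here `U` and `V` are the sums of `1 / √(n - t)`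
over `A` and `B` (`rateConst_mul_le`).

Either `Y` is at most `1 - ε` times its mean or the exponential factor is small; this gives the two
terms of the bound. The first is a Chernoff bound (`pi_expMeasure_sum_le`), whose variance ratio is
controlled by a reverse Cauchy-Schwarz inequality, as all weights lie between `1 / √n` and `1 /
√(δn)` (`cc_mul_sum_sq_le`). The second needs `gr ≤ U * V` (`gr_le_sum_mul_sum`): comparison with
integrals of `1 / √x` replaces `U * V` by a concave quadratic in one variable, whose least value is
at an end of the range allowed by `r`. A union bound over the pairs (`card_noEdge_pairs_le`)
finishes the proof. -/

namespace PrefAttach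

noncomputable section

/-! ### Ranks inside a vertex set -/

/-- The number of elements of `C` above `x`. -/
def topRank {n : ℕ} (C : Finset (Fin n)) (x : Fin n) : ℕ := Finset.card {y ∈ C | x < y}

/-- The weight `1 / √p`, where `p` is the largest position that `x` can have when the elements of
`C` are moved to the end of the vertex set. -/
def rankWeight {n : ℕ} (C : Finset (Fin n)) (x : Fin n) : ℝ := 1 / √((n : ℝ) - topRank C x)

section Rank

variable {n : ℕ} {C : Finset (Fin n)}

theorem topRank_lt_of_lt {x y : Fin n} (hy : y ∈ C) (h : x < y) :
    topRank C y < topRank C x := by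
  refine Finset.card_lt_card ?_
  refine ⟨fun z hz => ?_, fun hs => ?_⟩
  · simp only [Finset.mem_filter] at hz ⊢
    exact ⟨hz.1, h.trans hz.2⟩
  · have := hs (Finset.mem_filter.2 ⟨hy, h⟩)
    simp at this

theorem topRank_injOn : Set.InjOn (topRank C) C := by
  intro x hx y hy hxy
  rcases lt_trichotomy x y with h | h | h
  · exact absurd hxy (topRank_lt_of_lt hy h).ne'
  · exact h
  · exact absurd hxy (topRank_lt_of_lt hx h).ne

theorem topRank_lt_card {x : Fin n} (hx : x ∈ C) : topRank C x < C.card := by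
  refine Finset.card_lt_card ⟨Finset.filter_subset _ _, fun hs => ?_⟩
  have := hs hx
  simp at this

theorem image_topRank : C.image (topRank C) = Finset.range C.card := by
  refine Finset.eq_of_subset_of_card_le ?_ ?_
  · intro k hk
    obtain ⟨x, hx, rfl⟩ := Finset.mem_image.1 hk
    exact Finset.mem_range.2 (topRank_lt_card hx)
  · rw [Finset.card_image_of_injOn topRank_injOn, Finset.card_range]

theorem add_topRank_le (x : Fin n) : x.val + 1 + topRank C x ≤ n := by
  have h : topRank C x ≤ (Finset.Ioi x).card :=
    Finset.card_le_card fun y hy => Finset.mem_Ioi.2 (Finset.mem_filter.1 hy).2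
  rw [Fin.card_Ioi] at h
  have := x.isLt
  omega

theorem card_largest {k : ℕ} (hk : k ≤ C.card) : (largest k C).card = k := by
  have h : (largest k C).image (topRank C) = Finset.range k := by
    ext j
    simp only [Finset.mem_image, Finset.mem_range, largest, Finset.mem_filter]
    constructor
    · rintro ⟨x, ⟨-, hx⟩, rfl⟩
      exact hx
    · intro hj
      have : j ∈ C.image (topRank C) := by
        rw [image_topRank]; exact Finset.mem_range.2 (hj.trans_le hk)
      obtain ⟨x, hx, rfl⟩ := Finset.mem_image.1 this
      exact ⟨x, ⟨hx, hj⟩, rfl⟩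
  have h' := Finset.card_image_of_injOn (s := largest k C) (f := topRank C)
    (topRank_injOn.mono fun x hx => (Finset.mem_filter.1 hx).1)
  rw [h, Finset.card_range] at h'
  exact h'.symm

theorem largest_subset {k : ℕ} : largest k C ⊆ C := Finset.filter_subset _ _

end Rank

/-! ### Counting the pairs of vertex sets -/

/-- With `C = A ∪ B` and `L` the `μ` largest elements of `C`, the pair is recovered from `C`, `A ∩
L` and `A \ L`, since `B = C \ A`. The last two are subsets of sizes `μ - r` and `r` of sets of
sizes `μ` and `ν`. -/
theorem card_noEdge_pairs_le {n μ ν r : ℕ} (hr : r ≤ μ)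
    (P : Finset (Finset (Fin n) × Finset (Fin n)))
    (hP : ∀ p ∈ P, Disjoint p.1 p.2 ∧ p.1.card = μ ∧ p.2.card = ν ∧
      (p.1 ∩ largest μ (p.1 ∪ p.2)).card = μ - r) :
    P.card ≤ n.choose (μ + ν) * μ.choose r * ν.choose r := by
  let T : Finset (Σ _ : Finset (Fin n), Finset (Fin n) × Finset (Fin n)) :=
    (Finset.powersetCard (μ + ν) Finset.univ).sigma fun C =>
      Finset.powersetCard (μ - r) (largest μ C) ×ˢ Finset.powersetCard r (C \ largest μ C)
  have hT : T.card = n.choose (μ + ν) * μ.choose r * ν.choose r := by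
    rw [Finset.card_sigma, Finset.sum_congr rfl (g := fun _ => μ.choose r * ν.choose r)]
    · rw [Finset.sum_const, Finset.card_powersetCard, Finset.card_univ, Fintype.card_fin,
        smul_eq_mul, mul_assoc]
    · intro C hC
      have hC' := (Finset.mem_powersetCard.1 hC).2
      have hL : (largest μ C).card = μ := card_largest (by omega)
      rw [Finset.card_product, Finset.card_powersetCard, Finset.card_powersetCard, hL,
        Finset.card_sdiff_of_subset largest_subset, hL, hC', Nat.choose_symm hr]
      simp
  rw [← hT]
  refine Finset.card_le_card_of_injOn
    (fun p => ⟨p.1 ∪ p.2, p.1 ∩ largest μ (p.1 ∪ p.2), p.1 \ largest μ (p.1 ∪ p.2)⟩) ?_ ?_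
  · rintro ⟨A, B⟩ hp
    obtain ⟨hd, hA, hB, hL⟩ := hP _ hp
    simp only [T, Finset.mem_coe, Finset.mem_sigma, Finset.mem_powersetCard, Finset.mem_product] at *
    refine ⟨⟨Finset.subset_univ _, ?_⟩, ⟨Finset.inter_subset_right, hL⟩, ?_, ?_⟩
    · rw [Finset.card_union_of_disjoint hd, hA, hB]
    · exact Finset.sdiff_subset_sdiff Finset.subset_union_left le_rfl
    · have := Finset.card_sdiff_add_card_inter A (largest μ (A ∪ B))
      omega
  · rintro ⟨A, B⟩ hp ⟨A', B'⟩ hp' h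
    have hd : Disjoint A B := (hP _ hp).1
    have hd' : Disjoint A' B' := (hP _ hp').1
    simp only [Sigma.mk.injEq, heq_eq_eq, Prod.mk.injEq] at h
    obtain ⟨h1, h2, h3⟩ := h
    have hA : A = A' := by
      rw [← Finset.sdiff_union_inter A (largest μ (A ∪ B)), h2, h3, Finset.sdiff_union_inter]
    subst hA
    have hB : B = B' := by
      rw [← Finset.union_sdiff_cancel_left hd, h1, Finset.union_sdiff_cancel_left hd']
    rw [hB]

/-! ### Sums of a monotone function over sets of given size -/

/-- The initial interval `I` and `S` have equally many elements outside their intersection, and `f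
(a + S.card)` separates the values of `f` on `I \ S` from those on `S \ I`. -/
theorem sum_Ico_le_sum_of_monotoneOn {f : ℕ → ℝ} {a b : ℕ} (hf : MonotoneOn f (Set.Icc a b))
    {S : Finset ℕ} (hS : S ⊆ Finset.Ico a b) :
    ∑ k ∈ Finset.Ico a (a + S.card), f k ≤ ∑ k ∈ S, f k := by
  have hc : S.card ≤ b - a := by simpa using Finset.card_le_card hS
  rcases S.eq_empty_or_nonempty with rfl | ⟨x, hx⟩
  · simp
  have hab : a < b := by have := Finset.mem_Ico.1 (hS hx); omega
  set I := Finset.Ico a (a + S.card) with hI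
  have hIc : I.card = S.card := by simp [hI]
  have h1 : ∑ k ∈ I \ S, f k ≤ (I \ S).card • f (a + S.card) := by
    refine Finset.sum_le_card_nsmul _ _ _ fun k hk => ?_
    have := Finset.mem_Ico.1 (Finset.mem_sdiff.1 hk).1
    exact hf ⟨by omega, by omega⟩ ⟨by omega, by omega⟩ (by omega)
  have h2 : (S \ I).card • f (a + S.card) ≤ ∑ k ∈ S \ I, f k := by
    refine Finset.card_nsmul_le_sum _ _ _ fun k hk => ?_
    obtain ⟨hk1, hk2⟩ := Finset.mem_sdiff.1 hk
    have := Finset.mem_Ico.1 (hS hk1)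
    rw [hI, Finset.mem_Ico] at hk2
    exact hf ⟨by omega, by omega⟩ ⟨by omega, by omega⟩ (by omega)
  rw [← Finset.sum_inter_add_sum_sdiff I S, ← Finset.sum_inter_add_sum_sdiff S I,
    Finset.inter_comm S I]
  rw [Finset.card_sdiff_comm hIc] at h1
  linarith

theorem sum_le_sum_Ico_of_monotoneOn {f : ℕ → ℝ} {a b : ℕ} (hf : MonotoneOn f (Set.Icc a b))
    {S : Finset ℕ} (hS : S ⊆ Finset.Ico a b) :
    ∑ k ∈ S, f k ≤ ∑ k ∈ Finset.Ico (b - S.card) b, f k := by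
  have hc : S.card ≤ b - a := by simpa using Finset.card_le_card hS
  rcases S.eq_empty_or_nonempty with rfl | ⟨x, hx⟩
  · simp
  have hab : a < b := by have := Finset.mem_Ico.1 (hS hx); omega
  set I := Finset.Ico (b - S.card) b with hI
  have hIc : I.card = S.card := by simp [hI]; omega
  have h1 : (I \ S).card • f (b - S.card) ≤ ∑ k ∈ I \ S, f k := by
    refine Finset.card_nsmul_le_sum _ _ _ fun k hk => ?_
    have := Finset.mem_Ico.1 (Finset.mem_sdiff.1 hk).1
    exact hf ⟨by omega, by omega⟩ ⟨by omega, by omega⟩ (by omega)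
  have h2 : ∑ k ∈ S \ I, f k ≤ (S \ I).card • f (b - S.card) := by
    refine Finset.sum_le_card_nsmul _ _ _ fun k hk => ?_
    obtain ⟨hk1, hk2⟩ := Finset.mem_sdiff.1 hk
    have := Finset.mem_Ico.1 (hS hk1)
    rw [hI, Finset.mem_Ico] at hk2
    exact hf ⟨by omega, by omega⟩ ⟨by omega, by omega⟩ (by omega)
  rw [← Finset.sum_inter_add_sum_sdiff I S, ← Finset.sum_inter_add_sum_sdiff S I,
    Finset.inter_comm S I]
  rw [Finset.card_sdiff_comm hIc] at h1
  linarith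

/-! ### The integrals of `1 / √x` over unit intervals -/

/-- The integral of `1 / √x` over `[n - k, n - k + 1]`. -/
def unitGap (n k : ℕ) : ℝ := 2 * (√((n : ℝ) + 1 - k) - √((n : ℝ) - k))

/-- The sum telescopes; its first term for `a = 0` is the source of `N = n + 1` in the bound. -/
theorem sum_Ico_unitGap {n a b : ℕ} (h : a ≤ b) :
    ∑ k ∈ Finset.Ico a b, unitGap n k = 2 * (√((n : ℝ) + 1 - a) - √((n : ℝ) + 1 - b)) := by
  induction b, h using Nat.le_induction with
  | base => simp
  | succ b hab ih =>
    rw [Finset.sum_Ico_succ_top hab, ih, unitGap]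
    push_cast
    rw [show (n : ℝ) + 1 - (b + 1) = n - b by ring]
    ring

theorem unitGap_eq {n k : ℕ} (hk : k ≤ n) :
    unitGap n k = 2 / (√((n : ℝ) + 1 - k) + √((n : ℝ) - k)) := by
  have hk' : (k : ℝ) ≤ n := by exact_mod_cast hk
  have h0 : 0 < √((n : ℝ) + 1 - k) := Real.sqrt_pos.2 (by linarith)
  have h1 := Real.sqrt_nonneg ((n : ℝ) - k)
  rw [unitGap, eq_div_iff (by positivity)]
  have h2 := Real.sq_sqrt (show 0 ≤ (n : ℝ) + 1 - k by linarith)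
  have h3 := Real.sq_sqrt (show 0 ≤ (n : ℝ) - k by linarith)
  linear_combination 2 * h2 - 2 * h3

theorem monotoneOn_unitGap (n : ℕ) : MonotoneOn (unitGap n) (Set.Iic n) := by
  intro a ha b hb hab
  rw [unitGap_eq ha, unitGap_eq hb]
  have hb' : (b : ℝ) ≤ n := by exact_mod_cast hb
  have hab' : (a : ℝ) ≤ b := by exact_mod_cast hab
  have h0 : 0 < √((n : ℝ) + 1 - b) := Real.sqrt_pos.2 (by linarith)
  have h1 := Real.sqrt_nonneg ((n : ℝ) - b)
  gcongr

theorem unitGap_nonneg {n k : ℕ} (hk : k ≤ n) : 0 ≤ unitGap n k := by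
  rw [unitGap_eq hk]
  positivity

theorem unitGap_le {n k : ℕ} (hk : k < n) : unitGap n k ≤ 1 / √((n : ℝ) - k) := by
  have hk' : (k : ℝ) < n := by exact_mod_cast hk
  have h0 : 0 < √((n : ℝ) - k) := Real.sqrt_pos.2 (by linarith)
  have h1 : √((n : ℝ) - k) ≤ √((n : ℝ) + 1 - k) := Real.sqrt_le_sqrt (by linarith)
  rw [unitGap_eq hk.le, div_le_div_iff₀ (by linarith) h0]
  linarith

/-! ### The product of the two weight sums is at least `gr`. -/

/-- With `T = √N - √(N - μ - ν)`, the function `4 * S * (T - S)` is concave, so on `[e, f]` it is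
least at an endpoint. Since `D = T - e - f`, the sign of `D` tells which one: `e` if `D ≥ 0` and `f`
otherwise. -/
theorem gr_le_of_mem_Icc {N μ ν r S : ℝ}
    (h1 : √N - √(N - μ + r) + (√(N - μ) - √(N - μ - r)) ≤ S)
    (h2 : S ≤ √(N - r) - √(N - μ) + (√(N - μ - ν + r) - √(N - μ - ν))) :
    gr N μ ν r ≤ 4 * S * (√N - √(N - μ - ν) - S) := by
  -- Only this half of the minimum is needed: `h N ν μ` is exactly the term that `d₁` and `d₂`
  -- subtract from the endpoint values.
  have hg : g N μ ν ≤ h N ν μ := min_le_right _ _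
  have hN : N - ν - μ = N - μ - ν := by ring
  rw [h, hN] at hg
  rw [gr, d]
  set e := √N - √(N - μ + r) + (√(N - μ) - √(N - μ - r)) with he
  set f := √(N - r) - √(N - μ) + (√(N - μ - ν + r) - √(N - μ - ν)) with hf
  have hD : bigD N μ ν r = (√N - √(N - μ - ν)) - e - f := by rw [bigD, he, hf]; ring
  have hd1 : d₁ N μ ν r = 4 * e * (√N - √(N - μ - ν) - e)
      - 4 * (√(N - μ) - √(N - μ - ν)) * (√N - √(N - μ)) := by rw [d₁, he]; ring
  have hd2 : d₂ N μ ν r = 4 * f * (√N - √(N - μ - ν) - f)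
      - 4 * (√(N - μ) - √(N - μ - ν)) * (√N - √(N - μ)) := by rw [d₂, hf]; ring
  split_ifs with hc
  · rw [hD] at hc
    nlinarith [mul_nonneg (sub_nonneg.2 h1) hc, mul_nonneg (sub_nonneg.2 h1) (sub_nonneg.2 h2)]
  · rw [hD] at hc
    nlinarith [mul_nonneg (sub_nonneg.2 h2) (neg_nonneg.2 (not_le.1 hc).le),
      mul_nonneg (sub_nonneg.2 h1) (sub_nonneg.2 h2)]

section Pair

variable {n μ ν r : ℕ} {A B : Finset (Fin n)}

/-- The weights are bounded below by `unitGap`, which increases with the rank. `A` has `μ - r` ranks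
in `[0, μ)` and `r` ranks in `[μ, μ + ν)`. Pushing both groups down, or both up, inside these ranges
gives the two endpoints in `gr_le_of_mem_Icc`; the total over `C` depends on its size alone. -/
theorem gr_le_sum_mul_sum (hd : Disjoint A B) (hA : A.card = μ) (hB : B.card = ν)
    (hL : (A ∩ largest μ (A ∪ B)).card = μ - r) (hr : r ≤ μ) (hμν : μ ≤ ν) (hn : μ + ν ≤ n) :
    gr (n + 1) μ ν r ≤
      (∑ x ∈ A, rankWeight (A ∪ B) x) * ∑ x ∈ B, rankWeight (A ∪ B) x := by
  set C := A ∪ B with hC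
  have hCc : C.card = μ + ν := by rw [hC, Finset.card_union_of_disjoint hd, hA, hB]
  set L := largest μ C with hLdef
  have hAC : A ⊆ C := Finset.subset_union_left
  have hmono (a b : ℕ) (hb : b ≤ n) : MonotoneOn (unitGap n) (Set.Icc a b) :=
    (monotoneOn_unitGap n).mono fun k hk => hk.2.trans hb
  have hle : ∀ x ∈ C, unitGap n (topRank C x) ≤ rankWeight C x := fun x hx =>
    unitGap_le ((topRank_lt_card hx).trans_le (by omega))
  have hnn : ∀ x ∈ C, 0 ≤ unitGap n (topRank C x) := fun x hx =>
    unitGap_nonneg ((topRank_lt_card hx).le.trans (by omega))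
  have hT : ∑ x ∈ C, unitGap n (topRank C x) = 2 * (√((n : ℝ) + 1) - √((n : ℝ) + 1 - μ - ν)) := by
    rw [← Finset.sum_image (f := unitGap n) topRank_injOn, image_topRank, Finset.range_eq_Ico,
      sum_Ico_unitGap (Nat.zero_le _), hCc]
    push_cast
    rw [sub_zero, sub_sub]
  have hAd : (A \ L).card = r := by
    have := Finset.card_sdiff_add_card_inter A L
    omega
  have hi1 : Set.InjOn (topRank C) (A ∩ L : Finset (Fin n)) :=
    topRank_injOn.mono fun x hx => hAC (Finset.mem_inter.1 hx).1
  have hi2 : Set.InjOn (topRank C) (A \ L : Finset (Fin n)) :=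
    topRank_injOn.mono fun x hx => hAC (Finset.mem_sdiff.1 hx).1
  have hs1 : (A ∩ L).image (topRank C) ⊆ Finset.Ico 0 μ := by
    intro k hk
    obtain ⟨x, hx, rfl⟩ := Finset.mem_image.1 hk
    exact Finset.mem_Ico.2 ⟨Nat.zero_le _,
      (Finset.mem_filter.1 (Finset.mem_inter.1 hx).2).2⟩
  have hs2 : (A \ L).image (topRank C) ⊆ Finset.Ico μ (μ + ν) := by
    intro k hk
    obtain ⟨x, hx, rfl⟩ := Finset.mem_image.1 hk
    obtain ⟨hxA, hxL⟩ := Finset.mem_sdiff.1 hx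
    refine Finset.mem_Ico.2 ⟨?_, hCc ▸ topRank_lt_card (hAC hxA)⟩
    by_contra hlt
    exact hxL (Finset.mem_filter.2 ⟨hAC hxA, not_le.1 hlt⟩)
  have hc1 : ((A ∩ L).image (topRank C)).card = μ - r := by
    rw [Finset.card_image_of_injOn hi1, hL]
  have hc2 : ((A \ L).image (topRank C)).card = r := by
    rw [Finset.card_image_of_injOn hi2, hAd]
  have hA1 : ∑ x ∈ A, unitGap n (topRank C x) =
      ∑ k ∈ (A ∩ L).image (topRank C), unitGap n k
        + ∑ k ∈ (A \ L).image (topRank C), unitGap n k := by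
    rw [Finset.sum_image hi1, Finset.sum_image hi2, Finset.sum_inter_add_sum_sdiff]
  have l1 := sum_Ico_le_sum_of_monotoneOn (hmono 0 μ (by omega)) hs1
  have l2 := sum_Ico_le_sum_of_monotoneOn (hmono μ (μ + ν) hn) hs2
  have u1 := sum_le_sum_Ico_of_monotoneOn (hmono 0 μ (by omega)) hs1
  have u2 := sum_le_sum_Ico_of_monotoneOn (hmono μ (μ + ν) hn) hs2
  rw [hc1, sum_Ico_unitGap (by omega)] at l1 u1
  rw [hc2, sum_Ico_unitGap (by omega)] at l2 u2
  rw [show 0 + (μ - r) = μ - r by omega] at l1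
  rw [show μ - (μ - r) = r by omega] at u1
  rw [Nat.cast_sub hr] at l1
  rw [Nat.cast_sub (by omega : r ≤ μ + ν)] at u2
  push_cast at l1 l2 u1 u2
  rw [show (n : ℝ) + 1 - 0 = n + 1 by ring,
    show (n : ℝ) + 1 - (μ - r) = n + 1 - μ + r by ring] at l1
  rw [← sub_sub] at l2
  rw [show (n : ℝ) + 1 - (μ + ν - r) = n + 1 - μ - ν + r by ring, ← sub_sub] at u2
  have hTA : ∑ x ∈ A, unitGap n (topRank C x) + ∑ x ∈ B, unitGap n (topRank C x)
      = 2 * (√((n : ℝ) + 1) - √((n : ℝ) + 1 - μ - ν)) := by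
    rw [← hT, hC, Finset.sum_union hd]
  have hkey := gr_le_of_mem_Icc (N := (n : ℝ) + 1) (μ := μ) (ν := ν) (r := r)
    (S := (∑ x ∈ A, unitGap n (topRank C x)) / 2) (by linarith) (by linarith)
  have hBC : B ⊆ C := Finset.subset_union_right
  calc gr (n + 1) μ ν r
      ≤ (∑ x ∈ A, unitGap n (topRank C x)) * ∑ x ∈ B, unitGap n (topRank C x) := by
        refine hkey.trans (le_of_eq ?_)
        rw [eq_sub_of_add_eq' hTA]
        ring
    _ ≤ _ := mul_le_mul (Finset.sum_le_sum fun x hx => hle x (hAC hx))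
        (Finset.sum_le_sum fun x hx => hle x (hBC hx))
        (Finset.sum_nonneg fun x hx => hnn x (hBC hx))
        (Finset.sum_nonneg fun x hx => (hnn x (hAC hx)).trans (hle x (hAC hx)))

end Pair

/-! ### The coefficients of the exponential variables -/

/-- A reverse Cauchy-Schwarz inequality: sum `(x i - lo) * (hi - x i) ≥ 0` over `s`, then use `4 * p
* (q - p) ≤ q ^ 2`. -/
theorem four_mul_card_mul_sum_sq_le {ι : Type*} (s : Finset ι) (x : ι → ℝ) {lo hi : ℝ}
    (hx : ∀ i ∈ s, lo ≤ x i ∧ x i ≤ hi) (h0 : 0 ≤ lo * hi) :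
    4 * (lo * hi) * s.card * ∑ i ∈ s, x i ^ 2 ≤ ((lo + hi) * ∑ i ∈ s, x i) ^ 2 := by
  have h1 : ∑ i ∈ s, x i ^ 2 ≤ (lo + hi) * ∑ i ∈ s, x i - lo * hi * s.card := by
    rw [Finset.mul_sum, mul_comm _ (s.card : ℝ), ← nsmul_eq_mul, ← Finset.sum_const,
      ← Finset.sum_sub_distrib]
    refine Finset.sum_le_sum fun i hi' => ?_
    nlinarith [mul_nonneg (sub_nonneg.2 (hx i hi').1) (sub_nonneg.2 (hx i hi').2)]
  have h2 : 0 ≤ 4 * (lo * hi) * s.card := by positivity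
  nlinarith [mul_le_mul_of_nonneg_left h1 h2,
    sq_nonneg ((lo + hi) * ∑ i ∈ s, x i - 2 * (lo * hi * s.card))]

/-- The coefficient of the block `i` in the exponent, for the weights `u` and `v` of the two
vertex sets. -/
def pairCoef {n : ℕ} (u v : Fin n → ℝ) (i : Fin n) : ℝ :=
  ∑ j with i < j, (u i * v j + v i * u j)

section Coef

variable {n : ℕ} {u v : Fin n → ℝ}

theorem pairCoef_nonneg (hu : ∀ i, 0 ≤ u i) (hv : ∀ i, 0 ≤ v i) (i : Fin n) :
    0 ≤ pairCoef u v i :=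
  Finset.sum_nonneg fun j _ =>
    add_nonneg (mul_nonneg (hu i) (hv j)) (mul_nonneg (hv i) (hu j))

/-- In the expanded product each off-diagonal term `u i * v j` is charged to the smaller of its two
indices, and the diagonal vanishes. -/
theorem sum_pairCoef (h : ∀ i, u i * v i = 0) :
    ∑ i, pairCoef u v i = (∑ i, u i) * ∑ i, v i := by
  simp only [pairCoef, Finset.sum_add_distrib, Finset.sum_filter]
  rw [Finset.sum_comm (f := fun i j => if i < j then v i * u j else 0), ← Finset.sum_add_distrib,
    Finset.sum_mul_sum]
  refine Finset.sum_congr rfl fun i _ => ?_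
  rw [← Finset.sum_add_distrib]
  refine Finset.sum_congr rfl fun j _ => ?_
  rcases lt_trichotomy i j with hij | rfl | hij
  · simp [hij, hij.le]
  · simp [h]
  · simp [hij, hij.le, mul_comm]

theorem sum_pairCoef_sq_le (hu : ∀ i, 0 ≤ u i) (hv : ∀ i, 0 ≤ v i) (h : ∀ i, u i * v i = 0) :
    ∑ i, pairCoef u v i ^ 2 ≤
      (∑ i, v i) ^ 2 * ∑ i, u i ^ 2 + (∑ i, u i) ^ 2 * ∑ i, v i ^ 2 := by
  rw [Finset.mul_sum, Finset.mul_sum, ← Finset.sum_add_distrib]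
  refine Finset.sum_le_sum fun i _ => ?_
  have h1 : pairCoef u v i ≤ u i * (∑ j, v j) + v i * ∑ j, u j := by
    rw [pairCoef, Finset.sum_add_distrib, ← Finset.mul_sum, ← Finset.mul_sum]
    have hsub := Finset.filter_subset (fun j => i < j) Finset.univ
    refine add_le_add (mul_le_mul_of_nonneg_left ?_ (hu i)) (mul_le_mul_of_nonneg_left ?_ (hv i))
    · exact Finset.sum_le_sum_of_subset_of_nonneg hsub fun j _ _ => hv j
    · exact Finset.sum_le_sum_of_subset_of_nonneg hsub fun j _ _ => hu j
  -- The cross term of the square contains `u i * v i = 0`.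
  refine (pow_le_pow_left₀ (pairCoef_nonneg hu hv i) h1 2).trans (le_of_eq ?_)
  linear_combination 2 * (∑ j, v j) * (∑ j, u j) * h i

end Coef

/-- The weights of the elements of `A` inside `A ∪ B`, extended by zero. -/
def setWeight {n : ℕ} (C A : Finset (Fin n)) (i : Fin n) : ℝ :=
  if i ∈ A then rankWeight C i else 0

theorem setWeight_nonneg {n : ℕ} (C A : Finset (Fin n)) (i : Fin n) : 0 ≤ setWeight C A i := by
  rw [setWeight, rankWeight]
  split_ifs <;> positivity

theorem setWeight_mul_setWeight {n : ℕ} (C : Finset (Fin n)) {A B : Finset (Fin n)}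
    (hd : Disjoint A B) (i : Fin n) : setWeight C A i * setWeight C B i = 0 := by
  by_cases hA : i ∈ A
  · simp [setWeight, Finset.disjoint_left.1 hd hA]
  · simp [setWeight, hA]

theorem sum_setWeight {n : ℕ} (C A : Finset (Fin n)) :
    ∑ i, setWeight C A i = ∑ i ∈ A, rankWeight C i := by
  simp [setWeight]

theorem sum_setWeight_sq {n : ℕ} (C A : Finset (Fin n)) :
    ∑ i, setWeight C A i ^ 2 = ∑ i ∈ A, rankWeight C i ^ 2 := by
  simp [setWeight]

theorem card_mul_sum_rankWeight_sq_le {n : ℕ} {C A : Finset (Fin n)} (hAC : A ⊆ C) {δ : ℝ}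
    (h0 : 0 < δ) (hC : (C.card : ℝ) = (1 - δ) * n) :
    4 * √δ * A.card * ∑ i ∈ A, rankWeight C i ^ 2 ≤
      ((1 + √δ) * ∑ i ∈ A, rankWeight C i) ^ 2 := by
  rcases A.eq_empty_or_nonempty with rfl | ⟨x, -⟩
  · simp
  have hn : (0 : ℝ) < n := by
    have := x.pos
    exact_mod_cast this
  have hsn : 0 < √(n : ℝ) := Real.sqrt_pos.2 hn
  have hsd : 0 < √δ := Real.sqrt_pos.2 h0
  have key := four_mul_card_mul_sum_sq_le A (rankWeight C) (lo := 1 / √(n : ℝ))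
    (hi := 1 / (√δ * √(n : ℝ))) ?_ (by positivity)
  · have e1 : 1 / √(n : ℝ) * (1 / (√δ * √(n : ℝ))) = √δ * (1 / (√δ * √(n : ℝ))) ^ 2 := by
      field_simp
    have e2 : 1 / √(n : ℝ) + 1 / (√δ * √(n : ℝ)) = (1 + √δ) * (1 / (√δ * √(n : ℝ))) := by
      field_simp
      ring
    -- Both sides now carry the factor `hi ^ 2` with `hi = 1 / √(δn)`; cancelling it leaves
    -- constants in `√δ` only.
    rw [e1, e2] at key
    have hp : 0 < (1 / (√δ * √(n : ℝ))) ^ 2 := by positivity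
    refine le_of_mul_le_mul_right ?_ hp
    calc _ = _ := by ring
      _ ≤ _ := key
      _ = _ := by ring
  · intro i hi
    have hk : ((topRank C i : ℕ) : ℝ) ≤ C.card := by
      exact_mod_cast (topRank_lt_card (hAC hi)).le
    have hk0 : (0 : ℝ) ≤ topRank C i := Nat.cast_nonneg _
    have hδn : 0 < δ * n := by positivity
    rw [rankWeight, ← Real.sqrt_mul h0.le]
    constructor
    · gcongr
      · exact Real.sqrt_pos.2 (by nlinarith)
      · linarith
    · gcongr
      nlinarith

theorem cc_mul_sum_sq_le {n : ℕ} {A B : Finset (Fin n)} (hd : Disjoint A B) {δ : ℝ} (ε : ℝ)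
    (h0 : 0 < δ) (hC : (A.card : ℝ) + B.card = (1 - δ) * n) (hA : A.Nonempty) :
    cc ε δ * ((A.card * B.card : ℝ) / (A.card + B.card)) *
        (2 * ∑ i, pairCoef (setWeight (A ∪ B) A) (setWeight (A ∪ B) B) i ^ 2) ≤
      ε ^ 2 * (∑ i, pairCoef (setWeight (A ∪ B) A) (setWeight (A ∪ B) B) i) ^ 2 := by
  have hC' : ((A ∪ B).card : ℝ) = (1 - δ) * n := by
    rw [Finset.card_union_of_disjoint hd, ← hC]; push_cast; rfl
  have kA := card_mul_sum_rankWeight_sq_le (C := A ∪ B) Finset.subset_union_left h0 hC'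
  have kB := card_mul_sum_rankWeight_sq_le (C := A ∪ B) Finset.subset_union_right h0 hC'
  have hs := sum_pairCoef_sq_le (setWeight_nonneg (A ∪ B) A) (setWeight_nonneg (A ∪ B) B)
    (setWeight_mul_setWeight _ hd)
  rw [sum_pairCoef (setWeight_mul_setWeight _ hd)]
  rw [sum_setWeight_sq, sum_setWeight_sq] at hs
  simp only [sum_setWeight] at hs ⊢
  have hAp : (0 : ℝ) < A.card := by exact_mod_cast hA.card_pos
  have hBp : (0 : ℝ) ≤ B.card := Nat.cast_nonneg _
  have hsd : 0 < √δ := Real.sqrt_pos.2 h0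
  set a : ℝ := (A.card : ℝ)
  set b : ℝ := (B.card : ℝ)
  set s := √δ
  set U := ∑ i ∈ A, rankWeight (A ∪ B) i
  set V := ∑ i ∈ B, rankWeight (A ∪ B) i
  set QA := ∑ i ∈ A, rankWeight (A ∪ B) i ^ 2
  set QB := ∑ i ∈ B, rankWeight (A ∪ B) i ^ 2
  set S2 := ∑ i, pairCoef (setWeight (A ∪ B) A) (setWeight (A ∪ B) B) i ^ 2
  have hkey : 4 * s * (a * b) * S2 ≤ (a + b) * ((1 + s) * (U * V)) ^ 2 :=
    calc 4 * s * (a * b) * S2 ≤ 4 * s * (a * b) * (V ^ 2 * QA + U ^ 2 * QB) := by gcongr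
      _ = b * V ^ 2 * (4 * s * a * QA) + a * U ^ 2 * (4 * s * b * QB) := by ring
      _ ≤ b * V ^ 2 * ((1 + s) * U) ^ 2 + a * U ^ 2 * ((1 + s) * V) ^ 2 := by gcongr
      _ = _ := by ring
  rw [cc]
  have e : 2 * ε ^ 2 * s / (1 + s) ^ 2 * (a * b / (a + b)) * (2 * S2)
      = ε ^ 2 * (4 * s * (a * b) * S2) / ((1 + s) ^ 2 * (a + b)) := by
    field_simp
    ring
  rw [e, div_le_iff₀ (by positivity)]
  calc _ ≤ ε ^ 2 * ((a + b) * ((1 + s) * (U * V)) ^ 2) := by gcongr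
    _ = _ := by ring

/-! ### Lower tail of a weighted sum of exponential variables -/

theorem lintegral_fin_prod_eq_prod {n : ℕ} {E : Type*} [MeasurableSpace E] (μ : Measure E)
    [SigmaFinite μ] {f : Fin n → E → ENNReal} (hf : ∀ i, Measurable (f i)) :
    ∫⁻ x, ∏ i, f i (x i) ∂(Measure.pi fun _ => μ) = ∏ i, ∫⁻ x, f i x ∂μ := by
  induction n with
  | zero => simp
  | succ n ih =>
    have hm : Measurable fun x : Fin n → E => ∏ i, f i.succ (x i) :=
      Finset.measurable_prod _ fun i _ => (hf i.succ).comp (measurable_pi_apply i)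
    rw [Fin.prod_univ_succ, ← ih fun i => hf i.succ,
      ← lintegral_prod_mul (hf 0).aemeasurable hm.aemeasurable,
      ← (measurePreserving_piFinSuccAbove (fun _ : Fin (n + 1) => μ) 0).lintegral_comp_emb
        (MeasurableEquiv.measurableEmbedding _)]
    refine lintegral_congr fun x => ?_
    rw [Fin.prod_univ_succ]
    rfl

theorem expMeasure_eq_withDensity (r : ℝ) :
    expMeasure r = volume.withDensity (exponentialPDF r) := rfl

theorem measurable_exponentialPDF (r : ℝ) : Measurable (exponentialPDF r) :=
  (measurable_exponentialPDFReal r).ennreal_ofReal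

theorem lintegral_exp_neg_mul_expMeasure {s : ℝ} (hs : 0 ≤ s) :
    ∫⁻ x, ENNReal.ofReal (Real.exp (-(s * x))) ∂expMeasure 1 = ENNReal.ofReal (1 / (1 + s)) := by
  rw [expMeasure_eq_withDensity, lintegral_withDensity_eq_lintegral_mul _
    (measurable_exponentialPDF 1) (by fun_prop)]
  have h : ∀ x, (exponentialPDF 1 * fun x => ENNReal.ofReal (Real.exp (-(s * x)))) x
      = ENNReal.ofReal (1 / (1 + s)) * exponentialPDF (1 + s) x := by
    intro x
    rw [Pi.mul_apply]
    rcases lt_or_ge x 0 with hx | hx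
    · simp [exponentialPDF_of_neg hx]
    · rw [exponentialPDF_of_nonneg hx, exponentialPDF_of_nonneg hx,
        ← ENNReal.ofReal_mul (by positivity), ← ENNReal.ofReal_mul (by positivity), one_mul, ← Real.exp_add, ← mul_assoc, one_div, inv_mul_cancel₀ (by positivity), one_mul, one_mul]
      congr 2
      ring
  rw [lintegral_congr h, lintegral_const_mul _ (measurable_exponentialPDF _),
    lintegral_exponentialPDF_eq_one (by positivity), mul_one]

theorem ae_expMeasure_pos : ∀ᵐ x ∂expMeasure 1, 0 < x := by
  rw [expMeasure_eq_withDensity, ae_withDensity_iff (measurable_exponentialPDF 1)]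
  -- The density does not vanish at `0`, so this point is discarded as a null set.
  filter_upwards [Measure.ae_ne volume (0 : ℝ)] with x hx hp
  rcases lt_trichotomy x 0 with h | h | h
  · exact absurd (exponentialPDF_of_neg h) hp
  · exact absurd h hx
  · exact h

instance : IsProbabilityMeasure (expMeasure 1) := isProbabilityMeasure_expMeasure one_pos

theorem one_div_one_add_le_exp {x : ℝ} (hx : 0 ≤ x) :
    1 / (1 + x) ≤ Real.exp (-x + x ^ 2 / 2) := by
  -- From `log (1 + x) ≥ 2x / (x + 2)`; after clearing the denominator the difference is `x ^ 3 /
  -- 2`.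
  have h1 : x - x ^ 2 / 2 ≤ Real.log (1 + x) := by
    refine le_trans ?_ (Real.le_log_one_add_of_nonneg hx)
    rw [le_div_iff₀ (by positivity)]
    nlinarith [pow_nonneg hx 3]
  rw [one_div, ← Real.exp_log (show 0 < 1 + x by positivity), ← Real.exp_neg]
  exact Real.exp_le_exp.2 (by linarith)

theorem pi_expMeasure_sum_le {n : ℕ} {b : Fin n → ℝ} (hb : ∀ i, 0 ≤ b i) {ε : ℝ} (hε : 0 ≤ ε) :
    Measure.pi (fun _ : Fin n => expMeasure 1) {w | ∑ i, b i * w i ≤ (1 - ε) * ∑ i, b i} ≤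
      ENNReal.ofReal (Real.exp (-(ε ^ 2 * (∑ i, b i) ^ 2 / (2 * ∑ i, b i ^ 2)))) := by
  set S := ∑ i, b i with hS
  set Q := ∑ i, b i ^ 2 with hQ
  have hS0 : 0 ≤ S := Finset.sum_nonneg fun i _ => hb i
  have hQ0 : 0 ≤ Q := Finset.sum_nonneg fun i _ => sq_nonneg _
  -- If `Q = 0`, the quotient in the exponent is `0` by convention and the bound is `1`.
  rcases hQ0.eq_or_lt with h0 | hpos
  · rw [← h0]
    simpa using prob_le_one
  -- The minimiser of the Chernoff exponent `-t * ε * S + t ^ 2 * Q / 2`.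
  set t := ε * S / Q with ht
  have ht0 : 0 ≤ t := by positivity
  have hmeas : ∀ i, Measurable fun x : ℝ => ENNReal.ofReal (Real.exp (-((t * b i) * x))) :=
    fun i => by fun_prop
  have hset : MeasurableSet {w : Fin n → ℝ | ∑ i, b i * w i ≤ (1 - ε) * S} :=
    measurableSet_le (by fun_prop) measurable_const
  calc Measure.pi (fun _ : Fin n => expMeasure 1) {w | ∑ i, b i * w i ≤ (1 - ε) * S}
      = ∫⁻ w, Set.indicator {w : Fin n → ℝ | ∑ i, b i * w i ≤ (1 - ε) * S} 1 w
          ∂Measure.pi (fun _ : Fin n => expMeasure 1) := (lintegral_indicator_one hset).symm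
    _ ≤ ∫⁻ w, ENNReal.ofReal (Real.exp (t * ((1 - ε) * S))) *
          ∏ i, ENNReal.ofReal (Real.exp (-((t * b i) * w i)))
          ∂Measure.pi (fun _ : Fin n => expMeasure 1) := by
        refine lintegral_mono fun w => ?_
        rw [← ENNReal.ofReal_prod_of_nonneg fun i _ => (Real.exp_pos _).le, ← Real.exp_sum,
          ← ENNReal.ofReal_mul (Real.exp_pos _).le, ← Real.exp_add]
        by_cases hw : w ∈ {w : Fin n → ℝ | ∑ i, b i * w i ≤ (1 - ε) * S}
        swap
        · rw [Set.indicator_of_notMem hw]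
          exact bot_le
        rw [Set.indicator_of_mem hw, Pi.one_apply, ENNReal.one_le_ofReal]
        refine Real.one_le_exp ?_
        rw [Finset.sum_neg_distrib]
        simp only [mul_assoc]
        rw [← Finset.mul_sum]
        have : ∑ i, b i * w i ≤ (1 - ε) * S := hw
        nlinarith
    _ = ENNReal.ofReal (Real.exp (t * ((1 - ε) * S))) *
          ∏ i, ENNReal.ofReal (1 / (1 + t * b i)) := by
        rw [lintegral_const_mul _ (by fun_prop), lintegral_fin_prod_eq_prod _ hmeas]
        congr 1
        exact Finset.prod_congr rfl fun i _ =>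
          lintegral_exp_neg_mul_expMeasure (mul_nonneg ht0 (hb i))
    _ ≤ ENNReal.ofReal (Real.exp (t * ((1 - ε) * S))) *
          ∏ i, ENNReal.ofReal (Real.exp (-(t * b i) + (t * b i) ^ 2 / 2)) := by
        gcongr with i
        exact one_div_one_add_le_exp (mul_nonneg ht0 (hb i))
    _ = _ := by
        rw [← ENNReal.ofReal_prod_of_nonneg fun i _ => (Real.exp_pos _).le, ← Real.exp_sum,
          ← ENNReal.ofReal_mul (Real.exp_pos _).le, ← Real.exp_add]
        congr 2
        have e : ∑ i, (-(t * b i) + (t * b i) ^ 2 / 2) = -(t * S) + t ^ 2 * Q / 2 := by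
          rw [Finset.sum_add_distrib, Finset.sum_neg_distrib, ← Finset.mul_sum,
            ← Finset.sum_div]
          simp only [mul_pow]
          rw [← Finset.mul_sum]
        rw [e, ht]
        field_simp
        ring

/-! ### The chords of a diagram with given right endpoints -/

theorem measurable_leftDensity : Measurable fun p : ℝ × ℝ => leftDensity p.1 p.2 := by
  unfold leftDensity
  refine Measurable.ennreal_ofReal (Measurable.ite ?_ (by fun_prop) measurable_const)
  exact (measurableSet_lt measurable_const measurable_snd).inter
    (measurableSet_le measurable_snd measurable_fst)

theorem lintegral_Ioc_leftDensity {a b r : ℝ} (ha : 0 ≤ a) (hab : a ≤ b) (hbr : b ≤ r) :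
    ∫⁻ x in Set.Ioc a b, leftDensity r x = ENNReal.ofReal ((√b - √a) / √r) := by
  have hcont : ContinuousOn (fun x => √x / √r) (Set.Icc a b) := by fun_prop
  have hder : ∀ x ∈ Set.Ioo a b, HasDerivAt (fun x => √x / √r) (1 / (2 * √(r * x))) x := by
    intro x hx
    have hx0 : 0 < x := ha.trans_lt hx.1
    have hd := (Real.hasDerivAt_sqrt hx0.ne').div_const (√r)
    rwa [div_div, mul_assoc, mul_comm √x, ← Real.sqrt_mul (hx0.le.trans (hx.2.le.trans hbr))] at hd
  -- For `a = 0` the density is unbounded near the endpoint; integrability comes from the continuous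
  -- antiderivative and the sign of its derivative.
  have hint := intervalIntegral.integrableOn_deriv_of_nonneg hcont hder
    (fun x _ => by positivity)
  have hval := intervalIntegral.integral_eq_sub_of_hasDerivAt_of_le hab hcont hder
    ((intervalIntegrable_iff_integrableOn_Ioc_of_le hab).2 hint)
  rw [intervalIntegral.integral_of_le hab, ← sub_div] at hval
  rw [← hval, ofReal_integral_eq_lintegral_ofReal hint (ae_of_all _ fun x => by positivity)]
  refine setLIntegral_congr_fun measurableSet_Ioc fun x hx => ?_
  rw [leftDensity, if_pos ⟨ha.trans_lt hx.1, hx.2.trans hbr⟩]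

theorem lintegral_leftDensity {r : ℝ} (hr : 0 < r) : ∫⁻ x, leftDensity r x = 1 := by
  have h : ∀ x, leftDensity r x = (Set.Ioc 0 r).indicator (leftDensity r) x := by
    intro x
    by_cases hx : x ∈ Set.Ioc 0 r
    · rw [Set.indicator_of_mem hx]
    · rw [Set.indicator_of_notMem hx, leftDensity, if_neg (c := 0 < x ∧ x ≤ r) hx,
        ENNReal.ofReal_zero]
  rw [lintegral_congr h, lintegral_indicator measurableSet_Ioc,
    lintegral_Ioc_leftDensity le_rfl hr.le le_rfl, Real.sqrt_zero, sub_zero,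
    div_self (Real.sqrt_pos.2 hr).ne', ENNReal.ofReal_one]

theorem lintegral_compl_biUnion_leftDensity_le {ι : Type*} (s : Finset ι) {a b : ι → ℝ} {r : ℝ}
    (hr : 0 < r) (h : ∀ i ∈ s, 0 ≤ a i ∧ a i ≤ b i ∧ b i ≤ r)
    (hd : (s : Set ι).PairwiseDisjoint fun i => Set.Ioc (a i) (b i)) :
    ∫⁻ x in (⋃ i ∈ s, Set.Ioc (a i) (b i))ᶜ, leftDensity r x ≤
      ENNReal.ofReal (Real.exp (-∑ i ∈ s, (√(b i) - √(a i)) / √r)) := by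
  set q := ∑ i ∈ s, (√(b i) - √(a i)) / √r with hq
  have hm : MeasurableSet (⋃ i ∈ s, Set.Ioc (a i) (b i)) :=
    Finset.measurableSet_biUnion _ fun i _ => measurableSet_Ioc
  have hterm : ∀ i ∈ s, 0 ≤ (√(b i) - √(a i)) / √r := fun i hi =>
    div_nonneg (sub_nonneg.2 (Real.sqrt_le_sqrt (h i hi).2.1)) (Real.sqrt_nonneg _)
  have h1 : ∫⁻ x in ⋃ i ∈ s, Set.Ioc (a i) (b i), leftDensity r x = ENNReal.ofReal q := by
    rw [lintegral_biUnion_finset hd fun i _ => measurableSet_Ioc,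
      ENNReal.ofReal_sum_of_nonneg hterm]
    exact Finset.sum_congr rfl fun i hi =>
      lintegral_Ioc_leftDensity (h i hi).1 (h i hi).2.1 (h i hi).2.2
  have h2 := lintegral_add_compl (μ := volume) (leftDensity r) hm
  rw [h1, lintegral_leftDensity hr] at h2
  have h3 : ∫⁻ x in (⋃ i ∈ s, Set.Ioc (a i) (b i))ᶜ, leftDensity r x = 1 - ENNReal.ofReal q :=
    ENNReal.eq_sub_of_add_eq' ENNReal.one_ne_top (by rwa [add_comm])
  rw [h3, ← ENNReal.ofReal_one, ← ENNReal.ofReal_sub _ (Finset.sum_nonneg hterm)]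
  -- This is `1 - q ≤ exp (-q)`.
  exact ENNReal.ofReal_le_ofReal (by linarith [Real.add_one_le_exp (-q)])

/-- Conditioned on the exponential variables, the chords avoid given families of intervals
independently. -/
theorem pairingMeasure_avoid_le {N : ℕ} {ι : Type*} {V : Set (Fin (N + 1) → ℝ)}
    (hV : MeasurableSet V) (s : Fin N → Finset ι) {a b : ι → (Fin (N + 1) → ℝ) → ℝ}
    (ha : ∀ i, Measurable (a i)) (hb : ∀ i, Measurable (b i))
    (hR : ∀ j, Measurable fun w : Fin (N + 1) → ℝ => rightEnd w j)
    (hpos : ∀ w : Fin (N + 1) → ℝ, (∀ i, 0 < w i) → ∀ k : Fin N, 0 < rightEnd w (k.val + 1))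
    (h : ∀ w, (∀ i, 0 < w i) → ∀ k, ∀ i ∈ s k,
      0 ≤ a i w ∧ a i w ≤ b i w ∧ b i w ≤ rightEnd w (k.val + 1))
    (hd : ∀ w, (∀ i, 0 < w i) → ∀ k,
      (s k : Set ι).PairwiseDisjoint fun i => Set.Ioc (a i w) (b i w)) :
    pairingMeasure N {p | p.1 ∈ V ∧ ∀ k, ∀ i ∈ s k, p.2 k ∉ Set.Ioc (a i p.1) (b i p.1)} ≤
      ∫⁻ w in V, ENNReal.ofReal (Real.exp (-∑ k : Fin N, ∑ i ∈ s k,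
        (√(b i w) - √(a i w)) / √(rightEnd w (k.val + 1))))
        ∂Measure.pi fun _ : Fin (N + 1) => expMeasure 1 := by
  set P := Measure.pi fun _ : Fin (N + 1) => expMeasure 1
  let F : Fin N → Set ((Fin (N + 1) → ℝ) × ℝ) :=
    fun k => {q | ∀ i ∈ s k, q.2 ∉ Set.Ioc (a i q.1) (b i q.1)}
  have hF : ∀ k, MeasurableSet (F k) := by
    intro k
    have : F k = ⋂ i ∈ s k, ({q | a i q.1 < q.2} ∩ {q | q.2 ≤ b i q.1})ᶜ := by
      ext q; simp [F]
    rw [this]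
    refine Finset.measurableSet_biInter _ fun i _ => MeasurableSet.compl ?_
    exact (measurableSet_lt ((ha i).comp measurable_fst) measurable_snd).inter
      (measurableSet_le measurable_snd ((hb i).comp measurable_fst))
  -- The constraint on chord `k` is absorbed into its density, so that for fixed `w` the integrand
  -- is a product over the coordinates of `l`.
  let f : Fin N → (Fin (N + 1) → ℝ) × ℝ → ENNReal :=
    fun k => (F k).indicator fun q => leftDensity (rightEnd q.1 (k.val + 1)) q.2
  have hf : ∀ k, Measurable (f k) := fun k =>
    (measurable_leftDensity.comp (((hR _).comp measurable_fst).prodMk measurable_snd)).indicator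
      (hF k)
  have hprod : Measurable fun p : (Fin (N + 1) → ℝ) × (Fin N → ℝ) => ∏ k, f k (p.1, p.2 k) :=
    Finset.measurable_prod _ fun k _ => (hf k).comp
      (measurable_fst.prodMk ((measurable_pi_apply k).comp measurable_snd))
  have hE : MeasurableSet {p : (Fin (N + 1) → ℝ) × (Fin N → ℝ) |
      p.1 ∈ V ∧ ∀ k, ∀ i ∈ s k, p.2 k ∉ Set.Ioc (a i p.1) (b i p.1)} := by
    have : {p : (Fin (N + 1) → ℝ) × (Fin N → ℝ) |
        p.1 ∈ V ∧ ∀ k, ∀ i ∈ s k, p.2 k ∉ Set.Ioc (a i p.1) (b i p.1)} =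
        Prod.fst ⁻¹' V ∩ ⋂ k, (fun p : (Fin (N + 1) → ℝ) × (Fin N → ℝ) => (p.1, p.2 k)) ⁻¹' F k := by
      ext p; simp only [F, Set.mem_inter_iff, Set.mem_iInter, Set.mem_preimage, Set.mem_ofPred_eq]
    rw [this]
    exact (measurable_fst hV).inter (MeasurableSet.iInter fun k =>
      (measurable_fst.prodMk ((measurable_pi_apply k).comp measurable_snd)) (hF k))
  have hwpos : ∀ᵐ w ∂P, ∀ i, 0 < w i :=
    eventually_all.2 fun i => (Measure.tendsto_eval_ae_ae (i := i)).eventually ae_expMeasure_pos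
  calc pairingMeasure N {p | p.1 ∈ V ∧ ∀ k, ∀ i ∈ s k, p.2 k ∉ Set.Ioc (a i p.1) (b i p.1)}
      = ∫⁻ p, (Prod.fst ⁻¹' V).indicator
          (fun p : (Fin (N + 1) → ℝ) × (Fin N → ℝ) => ∏ k, f k (p.1, p.2 k)) p
          ∂(P.prod volume) := by
        rw [pairingMeasure, withDensity_apply _ hE, ← lintegral_indicator hE]
        refine lintegral_congr fun p => ?_
        by_cases hp : p.1 ∈ V
        · rw [Set.indicator_of_mem (s := Prod.fst ⁻¹' V) hp]
          by_cases hk : ∀ k, (p.1, p.2 k) ∈ F k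
          · rw [Set.indicator_of_mem (show p ∈ {p : (Fin (N + 1) → ℝ) × (Fin N → ℝ) |
              p.1 ∈ V ∧ ∀ k, ∀ i ∈ s k, p.2 k ∉ Set.Ioc (a i p.1) (b i p.1)} from ⟨hp, hk⟩)]
            exact Finset.prod_congr rfl fun k _ => (Set.indicator_of_mem (hk k)
              fun q => leftDensity (rightEnd q.1 (k.val + 1)) q.2).symm
          · rw [Set.indicator_of_notMem fun hmem => hk hmem.2]
            obtain ⟨k, hk⟩ := not_forall.1 hk
            exact (Finset.prod_eq_zero (Finset.mem_univ k) (Set.indicator_of_notMem hk _)).symm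
        · rw [Set.indicator_of_notMem (s := Prod.fst ⁻¹' V) hp,
            Set.indicator_of_notMem fun hmem => hp hmem.1]
    _ = ∫⁻ w, ∫⁻ l : Fin N → ℝ, (Prod.fst ⁻¹' V).indicator
          (fun p : (Fin (N + 1) → ℝ) × (Fin N → ℝ) => ∏ k, f k (p.1, p.2 k)) (w, l)
          ∂volume ∂P :=
        lintegral_prod _ (hprod.indicator (measurable_fst hV)).aemeasurable
    _ = ∫⁻ w in V, ∏ k, (∫⁻ x, f k (w, x)) ∂P := by
        rw [← lintegral_indicator hV]
        refine lintegral_congr fun w => ?_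
        by_cases hw : w ∈ V
        · rw [Set.indicator_of_mem hw, ← lintegral_fin_prod_eq_prod (volume : Measure ℝ)
            (f := fun k x => f k (w, x)) fun k => (hf k).comp measurable_prodMk_left]
          exact lintegral_congr fun l => Set.indicator_of_mem (s := Prod.fst ⁻¹' V) hw _
        · rw [Set.indicator_of_notMem hw]
          refine (lintegral_congr fun l => ?_).trans lintegral_zero
          exact Set.indicator_of_notMem (s := Prod.fst ⁻¹' V) hw _
    _ ≤ _ := by
        refine lintegral_mono_ae (ae_restrict_of_ae ?_)
        filter_upwards [hwpos] with w hw
        rw [← Finset.sum_neg_distrib, Real.exp_sum,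
          ENNReal.ofReal_prod_of_nonneg fun i _ => (Real.exp_pos _).le]
        refine Finset.prod_le_prod' fun k _ => ?_
        refine le_trans (le_of_eq ?_) (lintegral_compl_biUnion_leftDensity_le (s k)
          (hpos w hw k) (h w hw k) (hd w hw k))
        have hm : MeasurableSet (⋃ i ∈ s k, Set.Ioc (a i w) (b i w)) :=
          Finset.measurableSet_biUnion _ fun i _ => measurableSet_Ioc
        rw [← lintegral_indicator hm.compl]
        refine lintegral_congr fun x => ?_
        by_cases hx : x ∈ (⋃ i ∈ s k, Set.Ioc (a i w) (b i w))ᶜ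
        · rw [Set.indicator_of_mem hx]
          exact Set.indicator_of_mem (by simpa [F] using hx) _
        · rw [Set.indicator_of_notMem hx]
          exact Set.indicator_of_notMem (fun hF' => hx (by simpa [F] using hF')) _

/-! ### Partial sums and right endpoints -/

section PartialSum

variable {N : ℕ} {w : Fin (N + 1) → ℝ}

theorem measurable_partialSum (j : ℕ) :
    Measurable fun w : Fin (N + 1) → ℝ => partialSum w j := by
  unfold partialSum
  fun_prop

theorem measurable_rightEnd (j : ℕ) : Measurable fun w : Fin (N + 1) → ℝ => rightEnd w j :=
  (measurable_partialSum j).div (measurable_partialSum (N + 1))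

theorem partialSum_mono (hw : ∀ i, 0 < w i) : Monotone (partialSum w) := by
  intro i j hij
  refine Finset.sum_le_sum_of_subset_of_nonneg ?_ fun k _ _ => (hw k).le
  intro k hk
  simp only [Finset.mem_filter, Finset.mem_univ, true_and] at hk ⊢
  omega

theorem partialSum_nonneg (hw : ∀ i, 0 < w i) (j : ℕ) : 0 ≤ partialSum w j :=
  Finset.sum_nonneg fun i _ => (hw i).le

theorem partialSum_pos (hw : ∀ i, 0 < w i) {j : ℕ} (hj : 0 < j) : 0 < partialSum w j :=
  Finset.sum_pos (fun i _ => hw i) ⟨0, by simpa using hj⟩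

theorem rightEnd_mono (hw : ∀ i, 0 < w i) : Monotone (rightEnd w) := fun _ _ hij =>
  div_le_div_of_nonneg_right (partialSum_mono hw hij) (partialSum_nonneg hw _)

theorem rightEnd_nonneg (hw : ∀ i, 0 < w i) (j : ℕ) : 0 ≤ rightEnd w j :=
  div_nonneg (partialSum_nonneg hw _) (partialSum_nonneg hw _)

theorem rightEnd_pos (hw : ∀ i, 0 < w i) {j : ℕ} (hj : 0 < j) : 0 < rightEnd w j :=
  div_pos (partialSum_pos hw hj) (partialSum_pos hw (Nat.succ_pos N))

/-- The random normalisation `W_{N+1}` cancels, which leaves partial sums of independent variables.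
-/
theorem sqrt_rightEnd_sub_div (hw : ∀ i, 0 < w i) (i j k : ℕ) :
    (√(rightEnd w j) - √(rightEnd w i)) / √(rightEnd w k) =
      (√(partialSum w j) - √(partialSum w i)) / √(partialSum w k) := by
  have hT : 0 < √(partialSum w (N + 1)) := Real.sqrt_pos.2 (partialSum_pos hw (Nat.succ_pos N))
  simp only [rightEnd]
  rw [Real.sqrt_div (partialSum_nonneg hw _), Real.sqrt_div (partialSum_nonneg hw _),
    Real.sqrt_div (partialSum_nonneg hw _), ← sub_div, div_div_div_cancel_right₀ hT.ne']

end PartialSum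

/-! ### Blocks -/

section Block

variable {n m : ℕ}

theorem block_val (k : Fin (n * m)) : (block k).val = k.val / m := rfl

theorem sum_eq_sum_block (F : Fin (n * m) → ℝ) :
    ∑ l, F l = ∑ i : Fin n, ∑ k : Fin m, F (finProdFinEquiv (i, k)) := by
  rw [← finProdFinEquiv.sum_comp, Fintype.sum_prod_type]

theorem block_finProdFinEquiv (i : Fin n) (k : Fin m) : block (finProdFinEquiv (i, k)) = i :=
  congrArg Prod.fst (finProdFinEquiv.symm_apply_apply (i, k))

theorem sum_block (f : Fin n → ℝ) : ∑ l : Fin (n * m), f (block l) = m * ∑ i, f i := by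
  rw [sum_eq_sum_block, Finset.mul_sum]
  simp [block_finProdFinEquiv]

theorem partialSum_sub_partialSum (w : Fin (n * m + 1) → ℝ) (i : Fin n) :
    partialSum w (m * (i.val + 1)) - partialSum w (m * i.val) =
      ∑ k : Fin m, w (finProdFinEquiv (i, k)).castSucc := by
  have hi : m * (i.val + 1) ≤ n * m := by
    rw [mul_comm n m]; exact Nat.mul_le_mul_left m i.isLt
  have hi' : m * i.val ≤ n * m := (Nat.mul_le_mul_left m (Nat.le_succ _)).trans hi
  simp only [partialSum, Finset.sum_filter]
  rw [Fin.sum_univ_castSucc, Fin.sum_univ_castSucc, sum_eq_sum_block, sum_eq_sum_block]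
  simp only [Fin.val_castSucc, Fin.val_last, not_lt.2 hi, not_lt.2 hi', if_false, add_zero,
    finProdFinEquiv_apply_val]
  rw [← Finset.sum_sub_distrib, Finset.sum_eq_single i]
  · rw [← Finset.sum_sub_distrib]
    refine Finset.sum_congr rfl fun k _ => ?_
    have hk := k.isLt
    rw [if_pos (by rw [Nat.mul_succ]; omega), if_neg (by omega), sub_zero]
  · intro j _ hj
    rw [← Finset.sum_sub_distrib]
    refine Finset.sum_eq_zero fun k _ => ?_
    have hk := k.isLt
    rcases lt_or_gt_of_ne hj with h | h
    · have h1 := Nat.mul_le_mul_left m (Nat.succ_le_of_lt (Fin.lt_def.1 h))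
      rw [Nat.mul_succ] at h1
      rw [if_pos (by rw [Nat.mul_succ]; omega), if_pos (by omega), sub_self]
    · have h1 := Nat.mul_le_mul_left m (Nat.succ_le_of_lt (Fin.lt_def.1 h))
      rw [Nat.mul_succ] at h1
      rw [if_neg (by rw [Nat.mul_succ]; omega), if_neg (by omega), sub_self]
  · simp

/-- The coefficients of the exponential variables, constant on blocks. -/
def blockCoef (m : ℕ) (α : Fin n → ℝ) : Fin (n * m + 1) → ℝ :=
  Fin.snoc (α := fun _ => ℝ) (fun l : Fin (n * m) => α (block l)) 0

theorem sum_blockCoef (α : Fin n → ℝ) : ∑ l, blockCoef m α l = m * ∑ i, α i := by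
  simp [blockCoef, Fin.sum_univ_castSucc, sum_block]

theorem sum_blockCoef_sq (α : Fin n → ℝ) : ∑ l, blockCoef m α l ^ 2 = m * ∑ i, α i ^ 2 := by
  simp [blockCoef, Fin.sum_univ_castSucc, sum_block fun i => α i ^ 2]

theorem blockCoef_nonneg {α : Fin n → ℝ} (hα : ∀ i, 0 ≤ α i) (l : Fin (n * m + 1)) :
    0 ≤ blockCoef m α l := by
  refine Fin.lastCases ?_ (fun l => ?_) l
  · simp [blockCoef]
  · simpa [blockCoef] using hα _

theorem sum_blockCoef_mul (α : Fin n → ℝ) (w : Fin (n * m + 1) → ℝ) :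
    ∑ l, blockCoef m α l * w l =
      ∑ i : Fin n, α i * (partialSum w (m * (i.val + 1)) - partialSum w (m * i.val)) := by
  simp only [partialSum_sub_partialSum, Finset.mul_sum]
  rw [Fin.sum_univ_castSucc, sum_eq_sum_block]
  simp [blockCoef, block_finProdFinEquiv]

theorem exists_inChordVertex {w : Fin (n * m + 1) → ℝ} (hw : ∀ i, 0 < w i) {x : ℝ} {i : Fin n}
    (hx : x ∈ Set.Ioc (rightEnd w (m * i.val)) (rightEnd w (m * (i.val + 1)))) :
    ∃ k : Fin (n * m), InChordVertex w x k ∧ block k = i := by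
  classical
  have hm : 0 < m := by
    rcases Nat.eq_zero_or_pos m with rfl | h
    · simp at hx
    · exact h
  have hi : m * (i.val + 1) ≤ n * m := by
    rw [mul_comm n m]; exact Nat.mul_le_mul_left m i.isLt
  have hsucc : m * (i.val + 1) = m * i.val + m := Nat.mul_succ _ _
  have hex : ∃ k : ℕ, x ≤ rightEnd w (k + 1) :=
    ⟨m * (i.val + 1) - 1, by rw [Nat.sub_add_cancel (by omega)]; exact hx.2⟩
  have hle : Nat.find hex ≤ m * (i.val + 1) - 1 :=
    Nat.find_min' hex (by rw [Nat.sub_add_cancel (by omega)]; exact hx.2)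
  -- Chord `k` ends at `R_{k+1}`: an index below `m * i` would give `x ≤ R_{m * i}`.
  have hge : m * i.val ≤ Nat.find hex := by
    by_contra hlt
    exact absurd ((Nat.find_spec hex).trans (rightEnd_mono hw (not_le.1 hlt))) (not_le.2 hx.1)
  refine ⟨⟨Nat.find hex, by omega⟩, ⟨Nat.find_spec hex, fun j hj => ?_⟩, ?_⟩
  · exact not_le.1 (Nat.find_min hex hj)
  · refine Fin.ext ?_
    rw [block_val]
    refine Nat.div_eq_of_lt_le ?_ ?_
    · rw [mul_comm]; exact hge
    · have hlt : Nat.find hex < m * (i.val + 1) := by omega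
      exact hlt.trans_eq (mul_comm _ _)

end Block

/-! ### A fixed pair of vertex sets -/

/-- The vertices below `j` that the pair `A`, `B` forbids as neighbours of `j`. -/
def forbidden {n : ℕ} (A B : Finset (Fin n)) (j : Fin n) : Finset (Fin n) :=
  {i | i < j ∧ (i ∈ A ∧ j ∈ B ∨ i ∈ B ∧ j ∈ A)}

/-- The event `eventW` as a set of values of the exponential variables. -/
def boundedSums (n m : ℕ) (δ : ℝ) : Set (Fin (n * m + 1) → ℝ) :=
  {w | ∀ j : ℕ, δ * n ≤ j → j ≤ n →
    partialSum w (m * j) / (m * j : ℝ) ≤ 1 + (√(n : ℝ))⁻¹ * Real.log n}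

/-- The constant `c(n)`. -/
def rateConst (n : ℕ) : ℝ := 1 / (2 * (1 + (√(n : ℝ))⁻¹ * Real.log n))

section Fixed

variable {n m : ℕ} {A B : Finset (Fin n)} {δ ε : ℝ}

theorem measurableSet_boundedSums : MeasurableSet (boundedSums n m δ) := by
  have : boundedSums n m δ = ⋂ j : ℕ, ⋂ _ : δ * n ≤ j, ⋂ _ : j ≤ n,
      {w | partialSum w (m * j) / (m * j : ℝ) ≤ 1 + (√(n : ℝ))⁻¹ * Real.log n} := by
    ext w; simp [boundedSums]
  rw [this]
  exact MeasurableSet.iInter fun j => MeasurableSet.iInter fun _ => MeasurableSet.iInter fun _ =>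
    measurableSet_le ((measurable_partialSum _).div_const _) measurable_const

theorem error_nonneg (n : ℕ) : 0 ≤ (√(n : ℝ))⁻¹ * Real.log n :=
  mul_nonneg (inv_nonneg.2 (Real.sqrt_nonneg _)) (Real.log_natCast_nonneg n)

theorem partialSum_le_of_mem {C : Finset (Fin n)} (hm : 1 ≤ m)
    (hC : (C.card : ℝ) = (1 - δ) * n) {w : Fin (n * m + 1) → ℝ} (hw : ∀ i, 0 < w i)
    (hV : w ∈ boundedSums n m δ) {i : Fin n} (hi : i ∈ C) :
    √(partialSum w (m * (i.val + 1))) * rankWeight C i ≤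
      √(m * (1 + (√(n : ℝ))⁻¹ * Real.log n)) := by
  have hr := add_topRank_le (C := C) i
  have hrC : ((topRank C i : ℕ) : ℝ) ≤ C.card := by exact_mod_cast (topRank_lt_card hi).le
  have hcast : ((n - topRank C i : ℕ) : ℝ) = (n : ℝ) - topRank C i := Nat.cast_sub (by omega)
  have hp : (0 : ℝ) < (n : ℝ) - topRank C i := by
    rw [← hcast]; exact_mod_cast (by omega : 0 < n - topRank C i)
  have hm' : (0 : ℝ) < m := by exact_mod_cast hm
  -- The position `n - topRank C i` is at least `n - C.card = δ * n`, so it is among the indices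
  -- covered by the event; it is also at least `i + 1`.
  have h1 := hV (n - topRank C i) (by rw [hcast]; linarith) (Nat.sub_le _ _)
  rw [hcast, div_le_iff₀ (by positivity)] at h1
  have h2 : partialSum w (m * (i.val + 1)) ≤ partialSum w (m * (n - topRank C i)) :=
    partialSum_mono hw (Nat.mul_le_mul_left m (by omega))
  rw [rankWeight, mul_one_div, div_le_iff₀ (Real.sqrt_pos.2 hp), ← Real.sqrt_mul
    (mul_nonneg hm'.le (by linarith [error_nonneg n]))]
  exact Real.sqrt_le_sqrt (by linarith)

/-- Multiply `√y - √x` by its conjugate. The factor `2` in `rateConst` comes from `√x + √y ≤ 2 *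
√y`, and `m * (1 + η)` from applying `partialSum_le_of_mem` once to each end of the edge. -/
theorem le_sqrt_rightEnd_sub_div {C : Finset (Fin n)} (hm : 1 ≤ m)
    (hC : (C.card : ℝ) = (1 - δ) * n) {w : Fin (n * m + 1) → ℝ} (hw : ∀ i, 0 < w i)
    (hV : w ∈ boundedSums n m δ) {i : Fin n} (hi : i ∈ C) {k : Fin (n * m)} (hk : block k ∈ C) :
    rateConst n / m * (rankWeight C i * rankWeight C (block k)) *
        (partialSum w (m * (i.val + 1)) - partialSum w (m * i.val)) ≤
      (√(rightEnd w (m * (i.val + 1))) - √(rightEnd w (m * i.val))) /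
        √(rightEnd w (k.val + 1)) := by
  have hm' : (0 : ℝ) < m := by exact_mod_cast hm
  have hη := error_nonneg n
  have hai := partialSum_le_of_mem hm hC hw hV hi
  have hak := partialSum_le_of_mem hm hC hw hV hk
  have hkb : k.val + 1 ≤ m * ((block k).val + 1) := by
    rw [block_val]; exact Nat.lt_mul_div_succ k.val hm
  have hk1 : √(partialSum w (k.val + 1)) ≤ √(partialSum w (m * ((block k).val + 1))) :=
    Real.sqrt_le_sqrt (partialSum_mono hw hkb)
  have hpk : 0 < √(partialSum w (k.val + 1)) :=
    Real.sqrt_pos.2 (partialSum_pos hw (Nat.succ_pos _))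
  have hx0 := Real.sqrt_nonneg (partialSum w (m * i.val))
  have hxy : √(partialSum w (m * i.val)) ≤ √(partialSum w (m * (i.val + 1))) :=
    Real.sqrt_le_sqrt (partialSum_mono hw (Nat.mul_le_mul_left m (Nat.le_succ _)))
  have hsx := Real.sq_sqrt (partialSum_nonneg hw (m * i.val))
  have hsy := Real.sq_sqrt (partialSum_nonneg hw (m * (i.val + 1)))
  have hri : 0 ≤ rankWeight C i := by rw [rankWeight]; positivity
  have hrk : 0 ≤ rankWeight C (block k) := by rw [rankWeight]; positivity
  rw [sqrt_rightEnd_sub_div hw, le_div_iff₀ hpk, rateConst]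
  set x := √(partialSum w (m * i.val))
  set y := √(partialSum w (m * (i.val + 1)))
  set z := √(partialSum w (k.val + 1))
  set z' := √(partialSum w (m * ((block k).val + 1)))
  set η := (√(n : ℝ))⁻¹ * Real.log n
  set p := rankWeight C i
  set q := rankWeight C (block k)
  have hM : √(m * (1 + η)) * √(m * (1 + η)) = m * (1 + η) := Real.mul_self_sqrt (by positivity)
  have h1 : (y * p) * (z * q) ≤ m * (1 + η) := by
    rw [← hM]
    exact mul_le_mul hai ((mul_le_mul_of_nonneg_right hk1 hrk).trans hak) (by positivity)
      (Real.sqrt_nonneg _)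
  have h2 : (y + x) * (p * q * z) ≤ 2 * (m * (1 + η)) := by
    have : x * (p * q * z) ≤ y * (p * q * z) := mul_le_mul_of_nonneg_right hxy (by positivity)
    linarith
  have e : 1 / (2 * (1 + η)) / m * (p * q) * (y ^ 2 - x ^ 2) * z
      = (y - x) * ((y + x) * (p * q * z)) / (2 * (m * (1 + η))) := by
    field_simp
    ring
  rw [← hsx, ← hsy, e, div_le_iff₀ (by positivity)]
  exact mul_le_mul_of_nonneg_left h2 (sub_nonneg.2 hxy)

theorem sum_forbidden (hd : Disjoint A B) (C : Finset (Fin n)) (X : Fin n → ℝ) :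
    ∑ j, ∑ i ∈ forbidden A B j, rankWeight C i * rankWeight C j * X i =
      ∑ i, pairCoef (setWeight C A) (setWeight C B) i * X i := by
  simp only [forbidden, pairCoef, Finset.sum_mul, Finset.sum_filter]
  rw [Finset.sum_comm]
  refine Finset.sum_congr rfl fun i _ => Finset.sum_congr rfl fun j _ => ?_
  by_cases hij : i < j
  · have hi : i ∈ A → i ∉ B := fun h => Finset.disjoint_left.1 hd h
    have hj : j ∈ A → j ∉ B := fun h => Finset.disjoint_left.1 hd h
    by_cases hiA : i ∈ A <;> by_cases hiB : i ∈ B <;> by_cases hjA : j ∈ A <;>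
      by_cases hjB : j ∈ B <;> simp_all [setWeight]
  · simp [hij]

theorem rateConst_mul_le (hm : 1 ≤ m) (hd : Disjoint A B)
    (hC : ((A ∪ B).card : ℝ) = (1 - δ) * n) {w : Fin (n * m + 1) → ℝ} (hw : ∀ i, 0 < w i)
    (hV : w ∈ boundedSums n m δ) :
    rateConst n * ∑ l, blockCoef m
        (pairCoef (setWeight (A ∪ B) A) (setWeight (A ∪ B) B)) l * w l ≤
      ∑ k : Fin (n * m), ∑ i ∈ forbidden A B (block k),
        (√(rightEnd w (m * (i.val + 1))) - √(rightEnd w (m * i.val))) /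
          √(rightEnd w (k.val + 1)) := by
  have hm' : (m : ℝ) ≠ 0 := by positivity
  rw [sum_blockCoef_mul, ← sum_forbidden hd]
  -- The `m` chords of a block have the same lower bound; their number cancels the `1 / m` in the
  -- bound for one chord.
  have hsb := sum_block (m := m) fun j => ∑ i ∈ forbidden A B j,
    rankWeight (A ∪ B) i * rankWeight (A ∪ B) j *
      (partialSum w (m * (i.val + 1)) - partialSum w (m * i.val))
  rw [← inv_mul_eq_iff_eq_mul₀ hm'] at hsb
  rw [← hsb, ← mul_assoc, ← div_eq_mul_inv, Finset.mul_sum]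
  refine Finset.sum_le_sum fun k _ => ?_
  rw [Finset.mul_sum]
  refine Finset.sum_le_sum fun i hi => ?_
  rw [← mul_assoc]
  obtain ⟨-, h⟩ := (Finset.mem_filter.1 hi).2
  refine le_sqrt_rightEnd_sub_div hm hC hw hV ?_ ?_
  · rcases h with h | h
    · exact Finset.mem_union_left _ h.1
    · exact Finset.mem_union_right _ h.1
  · rcases h with h | h
    · exact Finset.mem_union_right _ h.2
    · exact Finset.mem_union_left _ h.2

end Fixed

/-- The event that the exponential variables satisfy `boundedSums` and no chord leads to a
forbidden neighbour. -/
def avoidEvent (n m : ℕ) (δ : ℝ) (A B : Finset (Fin n)) :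
    Set ((Fin (n * m + 1) → ℝ) × (Fin (n * m) → ℝ)) :=
  {p | p.1 ∈ boundedSums n m δ ∧ ∀ k, ∀ i ∈ forbidden A B (block k),
    p.2 k ∉ Set.Ioc (rightEnd p.1 (m * i.val)) (rightEnd p.1 (m * (i.val + 1)))}

theorem rateConst_pos (n : ℕ) : 0 < rateConst n := by
  have := error_nonneg n
  rw [rateConst]
  positivity

theorem rateConst_le (n : ℕ) : rateConst n ≤ 1 / 2 := by
  have := error_nonneg n
  exact one_div_le_one_div_of_le (by norm_num) (by linarith)

theorem tendsto_rateConst : Tendsto rateConst atTop (𝓝 (1 / 2)) := by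
  have h1 : Tendsto (fun x : ℝ => (√x)⁻¹ * Real.log x) atTop (𝓝 0) := by
    have := (isLittleO_log_rpow_atTop (show (0 : ℝ) < 1 / 2 by norm_num)).tendsto_div_nhds_zero
    refine this.congr fun x => ?_
    rw [Real.sqrt_eq_rpow, div_eq_inv_mul]
  have h2 := ((h1.comp tendsto_natCast_atTop_atTop).const_add 1).const_mul 2
  rw [add_zero, mul_one] at h2
  exact (tendsto_const_nhds (x := (1 : ℝ))).div h2 two_ne_zero

theorem ae_pairingMeasure_pos (N : ℕ) : ∀ᵐ p ∂pairingMeasure N, ∀ i, 0 < p.1 i := by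
  have hw : ∀ᵐ w ∂Measure.pi fun _ : Fin (N + 1) => expMeasure 1, ∀ i, 0 < w i :=
    eventually_all.2 fun i => (Measure.tendsto_eval_ae_ae (i := i)).eventually ae_expMeasure_pos
  exact (withDensity_absolutelyContinuous _ _).ae_le
    (Measure.quasiMeasurePreserving_fst.ae hw)

/-! ### The bound for one pair and the union bound. -/

section

variable {n m μ ν r : ℕ} {A B : Finset (Fin n)} {δ ε : ℝ}

theorem mem_avoidEvent {p : (Fin (n * m + 1) → ℝ) × (Fin (n * m) → ℝ)} (hp : ∀ i, 0 < p.1 i)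
    (hW : p ∈ eventW n m δ) (h : ∀ a ∈ A, ∀ b ∈ B, ¬ (prefGraph n m p.1 p.2).Adj a b) :
    p ∈ avoidEvent n m δ A B := by
  refine ⟨hW, fun k i hi hx => ?_⟩
  obtain ⟨k', hk', rfl⟩ := exists_inChordVertex hp hx
  obtain ⟨-, hi | hi⟩ := (Finset.mem_filter.1 hi).2
  · exact h _ hi.1 _ hi.2 ⟨k, k', hk', rfl⟩
  · exact h _ hi.2 _ hi.1 ⟨k, k', hk', Sym2.eq_swap⟩

theorem pairingMeasure_avoidEvent_le_lintegral (hm : 1 ≤ m) (hd : Disjoint A B)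
    (hC : ((A ∪ B).card : ℝ) = (1 - δ) * n) :
    pairingMeasure (n * m) (avoidEvent n m δ A B) ≤
      ∫⁻ w, ENNReal.ofReal (Real.exp (-(rateConst n * ∑ l, blockCoef m
        (pairCoef (setWeight (A ∪ B) A) (setWeight (A ∪ B) B)) l * w l)))
        ∂Measure.pi fun _ : Fin (n * m + 1) => expMeasure 1 := by
  refine (pairingMeasure_avoid_le measurableSet_boundedSums (fun k => forbidden A B (block k))
    (fun i => measurable_rightEnd _) (fun i => measurable_rightEnd _) measurable_rightEnd
    (fun w hw k => rightEnd_pos hw (Nat.succ_pos _)) ?_ ?_).trans ?_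
  · intro w hw k i hi
    have hik : i < block k := (Finset.mem_filter.1 hi).2.1
    refine ⟨rightEnd_nonneg hw _, rightEnd_mono hw (Nat.mul_le_mul_left m (Nat.le_succ _)),
      rightEnd_mono hw ?_⟩
    -- A forbidden block is strictly below the block of `k`, so its whole interval lies left of the
    -- right endpoint of the chord.
    calc m * (i.val + 1) ≤ m * (block k).val := Nat.mul_le_mul_left m hik
      _ ≤ k.val := by rw [block_val]; exact Nat.mul_div_le _ _
      _ ≤ k.val + 1 := Nat.le_succ _
  · intro w hw k i _ j _ hij
    wlog hlt : i < j generalizing i j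
    · exact (this (by assumption) (by assumption) hij.symm
        (lt_of_le_of_ne (not_lt.1 hlt) hij.symm)).symm
    refine Set.disjoint_left.2 fun x hx hx' => ?_
    exact absurd (hx.2.trans (rightEnd_mono hw (Nat.mul_le_mul_left m hlt))) (not_le.2 hx'.1)
  · refine le_trans ?_ (setLIntegral_le_lintegral (boundedSums n m δ) _)
    refine setLIntegral_mono_ae' measurableSet_boundedSums ?_
    have hw : ∀ᵐ w ∂Measure.pi fun _ : Fin (n * m + 1) => expMeasure 1, ∀ i, 0 < w i :=
      eventually_all.2 fun i => (Measure.tendsto_eval_ae_ae (i := i)).eventually ae_expMeasure_pos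
    filter_upwards [hw] with w hw hV
    exact ENNReal.ofReal_le_ofReal (Real.exp_le_exp.2 (neg_le_neg
      (rateConst_mul_le hm hd hC hw hV)))

/-- The integrand is at most `1` where `Y ≤ y` and at most `exp (-(c * y))` elsewhere. This
splitting produces the two exponentials of the theorem. -/
theorem lintegral_exp_neg_le {Ω : Type*} [MeasurableSpace Ω] (P : Measure Ω)
    [IsProbabilityMeasure P] {Y : Ω → ℝ} (hY : Measurable Y) {c : ℝ} (hc : 0 ≤ c) (y : ℝ)
    (hpos : ∀ᵐ w ∂P, 0 ≤ Y w) :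
    ∫⁻ w, ENNReal.ofReal (Real.exp (-(c * Y w))) ∂P ≤
      P {w | Y w ≤ y} + ENNReal.ofReal (Real.exp (-(c * y))) := by
  have hs : MeasurableSet {w | Y w ≤ y} := measurableSet_le hY measurable_const
  calc ∫⁻ w, ENNReal.ofReal (Real.exp (-(c * Y w))) ∂P
      ≤ ∫⁻ w, (Set.indicator {w | Y w ≤ y} 1 w + ENNReal.ofReal (Real.exp (-(c * y)))) ∂P := by
        refine lintegral_mono_ae ?_
        filter_upwards [hpos] with w hw
        by_cases h : w ∈ {w | Y w ≤ y}
        · rw [Set.indicator_of_mem h]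
          refine le_add_right ?_
          rw [Pi.one_apply, ENNReal.ofReal_le_one, Real.exp_le_one_iff]
          exact neg_nonpos.2 (mul_nonneg hc hw)
        · refine le_add_left (ENNReal.ofReal_le_ofReal (Real.exp_le_exp.2 (neg_le_neg ?_)))
          exact mul_le_mul_of_nonneg_left (not_le.1 h).le hc
    _ = _ := by
        rw [lintegral_add_right _ measurable_const, lintegral_indicator_one hs, lintegral_const,
          measure_univ, mul_one]

theorem pairingMeasure_avoidEvent_le (hm : 1 ≤ m) (h0 : 0 < δ) (hε : 0 ≤ ε) (hε1 : ε ≤ 1)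
    (hd : Disjoint A B) (hA : A.card = μ) (hB : B.card = ν)
    (hL : (A ∩ largest μ (A ∪ B)).card = μ - r) (hr : r ≤ μ) (hμν : μ ≤ ν) (hn : μ + ν ≤ n)
    (hC : (μ : ℝ) + ν = (1 - δ) * n) :
    pairingMeasure (n * m) (avoidEvent n m δ A B) ≤
      ENNReal.ofReal (Real.exp (-(m * cc ε δ * ((μ * ν : ℝ) / (μ + ν)))) +
        Real.exp (-(m * (rateConst n * (1 - ε)) * gr (n + 1) μ ν r))) := by
  have hC' : ((A ∪ B).card : ℝ) = (1 - δ) * n := by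
    rw [Finset.card_union_of_disjoint hd, hA, hB, ← hC]; push_cast; rfl
  have hm' : (0 : ℝ) < m := by exact_mod_cast hm
  set α := pairCoef (setWeight (A ∪ B) A) (setWeight (A ∪ B) B) with hα
  have hα0 : ∀ i, 0 ≤ α i :=
    pairCoef_nonneg (setWeight_nonneg (A ∪ B) A) (setWeight_nonneg (A ∪ B) B)
  have hb0 := blockCoef_nonneg (m := m) hα0
  have hw : ∀ᵐ w ∂Measure.pi fun _ : Fin (n * m + 1) => expMeasure 1, ∀ i, 0 < w i :=
    eventually_all.2 fun i => (Measure.tendsto_eval_ae_ae (i := i)).eventually ae_expMeasure_pos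
  have hsum : ∑ i, α i =
      (∑ x ∈ A, rankWeight (A ∪ B) x) * ∑ x ∈ B, rankWeight (A ∪ B) x := by
    rw [hα, sum_pairCoef (setWeight_mul_setWeight _ hd), sum_setWeight, sum_setWeight]
  have hg : gr (n + 1) μ ν r ≤ ∑ i, α i := by
    rw [hsum]; exact gr_le_sum_mul_sum hd hA hB hL hr hμν hn
  refine (pairingMeasure_avoidEvent_le_lintegral hm hd hC').trans ?_
  refine (lintegral_exp_neg_le _ (by fun_prop) (rateConst_pos n).le
    ((1 - ε) * ∑ l, blockCoef m α l) ?_).trans ?_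
  · filter_upwards [hw] with w hw
    exact Finset.sum_nonneg fun l _ => mul_nonneg (hb0 l) (hw l).le
  rw [ENNReal.ofReal_add (Real.exp_pos _).le (Real.exp_pos _).le]
  refine add_le_add ?_ (ENNReal.ofReal_le_ofReal (Real.exp_le_exp.2 (neg_le_neg ?_)))
  · rcases A.eq_empty_or_nonempty with hAe | hAn
    · have : μ = 0 := by rw [← hA, hAe, Finset.card_empty]
      -- For `μ = 0` the first exponential is `1`, which bounds any probability.
      subst this
      simpa using prob_le_one
    refine (pi_expMeasure_sum_le hb0 hε).trans
      (ENNReal.ofReal_le_ofReal (Real.exp_le_exp.2 (neg_le_neg ?_)))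
    rw [sum_blockCoef, sum_blockCoef_sq]
    have hBn : B.Nonempty := by
      rw [← Finset.card_pos] at hAn ⊢; omega
    have hwt : ∀ x ∈ A ∪ B, 0 < rankWeight (A ∪ B) x := by
      intro x hx
      have h1 : ((topRank (A ∪ B) x : ℕ) : ℝ) < n := by
        have := add_topRank_le (C := A ∪ B) x
        exact_mod_cast (by omega : topRank (A ∪ B) x < n)
      exact one_div_pos.2 (Real.sqrt_pos.2 (sub_pos.2 h1))
    have hS1 : 0 < ∑ i, α i := by
      rw [hsum]
      exact mul_pos (Finset.sum_pos (fun x hx => hwt x (Finset.mem_union_left _ hx)) hAn)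
        (Finset.sum_pos (fun x hx => hwt x (Finset.mem_union_right _ hx)) hBn)
    have hS2 : 0 < ∑ i, α i ^ 2 := by
      obtain ⟨i, hi, hne⟩ := Finset.exists_ne_zero_of_sum_ne_zero hS1.ne'
      exact Finset.sum_pos' (fun i _ => sq_nonneg _) ⟨i, hi, by positivity⟩
    have key := cc_mul_sum_sq_le hd ε h0 (by rw [hA, hB]; exact hC) hAn
    rw [hA, hB, ← hα] at key
    rw [le_div_iff₀ (by positivity)]
    calc m * cc ε δ * ((μ * ν : ℝ) / (μ + ν)) * (2 * (m * ∑ i, α i ^ 2))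
        = m ^ 2 * (cc ε δ * ((μ * ν : ℝ) / (μ + ν)) * (2 * ∑ i, α i ^ 2)) := by ring
      _ ≤ m ^ 2 * (ε ^ 2 * (∑ i, α i) ^ 2) := by gcongr
      _ = _ := by ring
  · rw [sum_blockCoef]
    have hk : 0 ≤ m * (rateConst n * (1 - ε)) :=
      mul_nonneg hm'.le (mul_nonneg (rateConst_pos n).le (sub_nonneg.2 hε1))
    calc m * (rateConst n * (1 - ε)) * gr (n + 1) μ ν r
        ≤ m * (rateConst n * (1 - ε)) * ∑ i, α i := mul_le_mul_of_nonneg_left hg hk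
      _ = _ := by ring

theorem probNoEdge_le (hm : 1 ≤ m) (h0 : 0 < δ) (hε : 0 ≤ ε) (hε1 : ε ≤ 1)
    (hr : r ≤ μ) (hμν : μ ≤ ν) (hC : (μ : ℝ) + ν = (1 - δ) * n) :
    probNoEdge n m μ ν r δ ≤
      ENNReal.ofReal ((n.choose (μ + ν) : ℝ) * (μ.choose r : ℝ) * (ν.choose r : ℝ) *
        (Real.exp (-(m * cc ε δ * ((μ * ν : ℝ) / (μ + ν)))) +
          Real.exp (-(m * (rateConst n * (1 - ε)) * gr (n + 1) μ ν r)))) := by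
  classical
  have hn : μ + ν ≤ n := by
    have h1 : (μ : ℝ) + ν ≤ n := by
      rw [hC]; nlinarith [Nat.cast_nonneg (α := ℝ) n]
    exact_mod_cast h1
  set E := Real.exp (-(m * cc ε δ * ((μ * ν : ℝ) / (μ + ν)))) +
    Real.exp (-(m * (rateConst n * (1 - ε)) * gr (n + 1) μ ν r)) with hE
  let P : Finset (Finset (Fin n) × Finset (Fin n)) :=
    {p | Disjoint p.1 p.2 ∧ p.1.card = μ ∧ p.2.card = ν ∧
      (p.1 ∩ largest μ (p.1 ∪ p.2)).card = μ - r}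
  have hcard : P.card ≤ n.choose (μ + ν) * μ.choose r * ν.choose r :=
    card_noEdge_pairs_le hr P fun p hp => (Finset.mem_filter.1 hp).2
  calc probNoEdge n m μ ν r δ
      ≤ pairingMeasure (n * m) (⋃ p ∈ P, avoidEvent n m δ p.1 p.2) := by
        refine measure_mono_ae ?_
        -- The inclusion of events needs increasing right endpoints, hence positive variables, and
        -- so holds only almost everywhere.
        filter_upwards [ae_pairingMeasure_pos (n * m)] with q hq hmem
        obtain ⟨hW, A, B, hd, hA, hB, hL, h⟩ := hmem
        exact Set.mem_biUnion (x := (A, B))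
          (Finset.mem_filter.2 ⟨Finset.mem_univ _, hd, hA, hB, hL⟩) (mem_avoidEvent hq hW h)
    _ ≤ ∑ p ∈ P, pairingMeasure (n * m) (avoidEvent n m δ p.1 p.2) :=
        measure_biUnion_finset_le _ _
    _ ≤ ∑ _p ∈ P, ENNReal.ofReal E := by
        refine Finset.sum_le_sum fun p hp => ?_
        obtain ⟨hd, hA, hB, hL⟩ := (Finset.mem_filter.1 hp).2
        exact pairingMeasure_avoidEvent_le hm h0 hε hε1 hd hA hB hL hr hμν hn hC
    _ = ENNReal.ofReal (P.card * E) := by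
        rw [Finset.sum_const, nsmul_eq_mul, ENNReal.ofReal_mul (Nat.cast_nonneg _),
          ENNReal.ofReal_natCast]
    _ ≤ _ := by
        refine ENNReal.ofReal_le_ofReal (mul_le_mul_of_nonneg_right ?_ (by positivity))
        exact_mod_cast hcard

end

end

end PrefAttach

theorem mainTheorem6 :
    ∃ c : ℕ → ℝ, (∀ n, 0 < c n ∧ c n ≤ 1 / 2) ∧ Tendsto c atTop (𝓝 (1 / 2)) ∧
      ∀ (n m μ ν r : ℕ) (δ ε : ℝ), 1 ≤ n → 1 ≤ m → 0 < δ → δ < 1 → 0 < ε → ε < 1 →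
        r ≤ μ → μ ≤ ν → (μ : ℝ) + ν = (1 - δ) * n →
        PrefAttach.probNoEdge n m μ ν r δ ≤
          ENNReal.ofReal
            ((n.choose (μ + ν) : ℝ) * (μ.choose r : ℝ) * (ν.choose r : ℝ) *
              (Real.exp (-(m * PrefAttach.cc ε δ * ((μ * ν : ℝ) / (μ + ν)))) +
                Real.exp (-(m * (c n * (1 - ε)) * PrefAttach.gr (n + 1) μ ν r)))) :=
  ⟨PrefAttach.rateConst, fun n => ⟨PrefAttach.rateConst_pos n, PrefAttach.rateConst_le n⟩,
    PrefAttach.tendsto_rateConst, fun _ _ _ _ _ _ _ _ hm h0 _ hε hε1 hr hμν hC =>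
      PrefAttach.probNoEdge_le hm h0 hε.le hε1.le hr hμν hC⟩
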